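/- Let $d\ge 2$, $\alpha=\frac{2}{d-1}$, and let $\sigma$ be the surface measure on the unit sphere $\mathbb S^{d-1}\subset\mathbb R^d$. Fix a query $q\in\mathbb S^{d-1}$ and a matrix $V\in\mathbb R^{d\times d}$. Let $x_1,x_2,\dots$ be i.i.d. random points of $\mathbb S^{d-1}$ with law $\rho\,d\sigma$, where the density $\rho\ge 0$ is of class $C^2$ on $\mathbb S^{d-1}$ and $\rho(q)>0$. For real numbers $\beta_n$ set $$A_j=\frac{e^{\beta_n\langle q,x_j\rangle}}{\sum_{l=1}^n e^{\beta_n\langle q,x_l\rangle}}\ (1\le j\le n),\qquad \mathrm{ATT}(n)=V\sum_{j=1}^n A_jx_j,\qquad \mathcal Y_n(q)=\mathrm{ATT}(n)-Vq .$$ Let $F(t)=\mathbb P(1-\langle q,x_1\rangle\le t)$. Then the limit $C(q)=\lim_{t\to0^+}F(t)\,t^{-1/\alpha}$ exists and lies in $(0,\infty)$, and, with $a_n=(C(q)n)^\alpha$, the following holds. **Theorem 4.1.** If $\beta_n n^{-\alpha}\to\infty$ as $n\to\infty$, then $$\sqrt{a_n}\,\mathcal Y_n(q)\longrightarrow V\Phi\quad\text{in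 distribution},\qquad \Phi=\sqrt{2R_1}\,\Theta_1,$$ where $R_1$ is a Weibull random variable with $\mathbb P(R_1>r)=e^{-r^{1/\alpha}}$ for all $r\ge0$, and $\Theta_1$ is independent of $R_1$ and uniformly distributed on $\{\theta\in\mathbb R^d:\langle\theta,q\rangle=0,\ \|\theta\|=1\}$, the unit sphere of the tangent space $T_q\mathbb S^{d-1}$. In particular, $\mathcal Y_n(q)\to0$ in probability, and hence $\mathrm{ATT}(n)\to Vq$ in probability. -/

import Mathlib

open MeasureTheory ProbabilityTheory Filter Topology
open scoped Manifold

/-- The unit sphere of `ℝ^d` (Euclidean norm). -/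
abbrev UnitSphere (d : ℕ) : Type :=
  Metric.sphere (0 : EuclideanSpace ℝ (Fin d)) 1

/-- The exponent `α = 2 / (d - 1)`. -/
noncomputable def alphaExp (d : ℕ) : ℝ := 2 / ((d : ℝ) - 1)

/-- Softmax attention weights of the context `x` for the query `q` at inverse temperature `β`. -/
noncomputable def attentionWeight {d n : ℕ} (β : ℝ) (q : UnitSphere d)
    (x : Fin n → UnitSphere d) (j : Fin n) : ℝ :=
  Real.exp (β * inner ℝ (q : EuclideanSpace ℝ (Fin d)) (x j)) /
    ∑ l, Real.exp (β * inner ℝ (q : EuclideanSpace ℝ (Fin d)) (x l))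

/-- The attention output `V ∑ j, A j • x j`. -/
noncomputable def attentionOutput {d n : ℕ} (V : Matrix (Fin d) (Fin d) ℝ) (β : ℝ)
    (q : UnitSphere d) (x : Fin n → UnitSphere d) : EuclideanSpace ℝ (Fin d) :=
  Matrix.toEuclideanCLM (𝕜 := ℝ) V
    (∑ j, attentionWeight β q x j • (x j : EuclideanSpace ℝ (Fin d)))

/-- The displacement: the attention output minus `V q`. -/
noncomputable def attentionDisplacement {d n : ℕ} (V : Matrix (Fin d) (Fin d) ℝ) (β : ℝ)
    (q : UnitSphere d) (x : Fin n → UnitSphere d) : EuclideanSpace ℝ (Fin d) :=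
  attentionOutput V β q x - Matrix.toEuclideanCLM (𝕜 := ℝ) V (q : EuclideanSpace ℝ (Fin d))

/-- Surface measure on the unit sphere of `ℝ^d`. -/
noncomputable def surfaceMeasure (d : ℕ) : Measure (UnitSphere d) :=
  (volume : Measure (EuclideanSpace ℝ (Fin d))).toSphere

/-- The measure with density `ρ` with respect to surface measure. -/
noncomputable def contextLaw {d : ℕ} (ρ : UnitSphere d → ℝ) : Measure (UnitSphere d) :=
  (surfaceMeasure d).withDensity fun x => ENNReal.ofReal (ρ x)

theorem finrank_fact_of_two_le {d : ℕ} (hd : 2 ≤ d) :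
    Fact (Module.finrank ℝ (EuclideanSpace ℝ (Fin d)) = (d - 1) + 1) :=
  ⟨by rw [finrank_euclideanSpace_fin]; omega⟩

/-- `ρ` is of class `C²` on the sphere, regarded as a `(d - 1)`-dimensional manifold. -/
def IsC2OnSphere {d : ℕ} (hd : 2 ≤ d) (ρ : UnitSphere d → ℝ) : Prop :=
  haveI := finrank_fact_of_two_le hd
  ContMDiff (𝓡 (d - 1)) 𝓘(ℝ, ℝ) 2 ρ

/-- The context `X 0, X 1, …` is i.i.d. on the sphere with a `C²` density `ρ` with respect to
surface measure which is positive at the query `q`. -/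
structure IsIIDSphericalContext {d : ℕ} (hd : 2 ≤ d) {Ω : Type*} [MeasurableSpace Ω]
    (P : Measure Ω) (q : UnitSphere d) (ρ : UnitSphere d → ℝ)
    (X : ℕ → Ω → UnitSphere d) : Prop where
  measurable : ∀ i, Measurable (X i)
  indep : iIndepFun X P
  law : ∀ i, P.map (X i) = contextLaw ρ
  density_nonneg : ∀ x, 0 ≤ ρ x
  density_pos : 0 < ρ q
  density_C2 : IsC2OnSphere hd ρ

/-- The distribution function `F(t)` of the distance-to-query `T = 1 - ⟨q, x⟩`, where `x` has
density `ρ`. -/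
noncomputable def d2qCDF {d : ℕ} (q : UnitSphere d) (ρ : UnitSphere d → ℝ) (t : ℝ) : ℝ :=
  (contextLaw ρ).real {x | 1 - inner ℝ (q : EuclideanSpace ℝ (Fin d)) x ≤ t}

/-- The local intensity `C(q) = lim_{t → 0+} F(t) t^{-1/α}`. -/
noncomputable def localIntensity {d : ℕ} (q : UnitSphere d) (ρ : UnitSphere d → ℝ) : ℝ :=
  limUnder (𝓝[>] (0 : ℝ)) fun t => d2qCDF q ρ t * t ^ (-(1 / alphaExp d))

/-- The tangent space at `q` to the unit sphere: the orthogonal complement of `q`. -/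
noncomputable abbrev TangentAt {d : ℕ} (q : UnitSphere d) : Submodule ℝ (EuclideanSpace ℝ (Fin d)) :=
  (Submodule.span ℝ {(q : EuclideanSpace ℝ (Fin d))})ᗮ

/-- The unit sphere of the tangent space at `q`. -/
abbrev TangentSphere {d : ℕ} (q : UnitSphere d) : Type :=
  Metric.sphere (0 : TangentAt q) 1

/-- Surface measure on the tangent unit sphere, obtained from the Lebesgue measure of the Euclidean
space `TangentAt q`. -/
noncomputable def tangentSurface {d : ℕ} (q : UnitSphere d) : Measure (TangentSphere q) :=
  (volume : Measure (TangentAt q)).toSphere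

/-- The uniform probability measure on the tangent unit sphere. -/
noncomputable def tangentUniform {d : ℕ} (q : UnitSphere d) : Measure (TangentSphere q) :=
  (tangentSurface q Set.univ)⁻¹ • tangentSurface q

/-- `R` is a Weibull variable: `P(R > r) = exp(-r^{1/α})` for all `r ≥ 0`. -/
structure IsWeibull {Ω : Type*} [MeasurableSpace Ω] (P : Measure Ω) (α : ℝ) (R : Ω → ℝ) :
    Prop where
  measurable : Measurable R
  tail : ∀ r : ℝ, 0 ≤ r → P.real {ω | r < R ω} = Real.exp (-(r ^ (1 / α)))

open scoped Pointwise

/-! The gnomonic chart at `q` flattens a neighbourhood of `q` in the sphere to the tangent space,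
and the law of the context has there a density that is continuous at the origin. At the spatial
scale `1 / s` with `s ^ (d - 1) = C(q) n`, only boundedly many context points remain near `q`, the
rescaled nearest one having the limiting density proportional to `exp (-(‖u‖ / √2) ^ (d - 1))`:
its radius is `√(2 R)` for a Weibull variable `R`, and its direction is uniform. The point at depth
`D = 1 - ⟪q, x⟫` has weight proportional to `exp (-β D)`, so for `β ≫ s ^ 2` the attention output
differs from the nearest point by `o(1 / s)`: the error is controlled by a sum over pairs of points
of comparable depth, whose expectation is small because such pairs are rare. -/

section Gnomonic

variable {d : ℕ} (q : UnitSphere d)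

/-- The distance-to-query statistic `1 - ⟨q, x⟩` of a point of the sphere. -/
noncomputable def queryDepth (x : UnitSphere d) : ℝ := 1 - inner ℝ q.1 x.1

theorem continuous_queryDepth : Continuous (queryDepth q) := by
  unfold queryDepth
  fun_prop

theorem queryDepth_nonneg (x : UnitSphere d) : 0 ≤ queryDepth q x :=
  sub_nonneg.2 (real_inner_le_one_of_norm_eq_one (norm_eq_of_mem_sphere q)
    (norm_eq_of_mem_sphere x))

theorem inner_tangent (v : TangentAt q) : inner ℝ q.1 v.1 = 0 :=
  Submodule.mem_orthogonal_singleton_iff_inner_right.1 v.2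

theorem inner_add_tangent (v : TangentAt q) : inner ℝ q.1 (q.1 + v) = 1 := by
  rw [inner_add_right, inner_tangent, real_inner_self_eq_norm_sq, norm_eq_of_mem_sphere]
  norm_num

theorem norm_add_tangent (v : TangentAt q) : ‖q.1 + v.1‖ = √(1 + ‖v‖ ^ 2) := by
  rw [eq_comm, Real.sqrt_eq_iff_mul_self_eq (by positivity) (norm_nonneg _),
    norm_add_mul_self_real, inner_tangent, norm_eq_of_mem_sphere, Submodule.coe_norm]
  ring

/-- The gnomonic chart of the open hemisphere around `q`: the central projection to the sphere of
the affine tangent space at `q`. -/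
noncomputable def gnomonicChart (v : TangentAt q) : UnitSphere d :=
  ⟨(√(1 + ‖v‖ ^ 2))⁻¹ • (q.1 + v), by
    have : 0 < √(1 + ‖v‖ ^ 2) := by positivity
    rw [mem_sphere_zero_iff_norm, norm_smul, norm_add_tangent, norm_inv, Real.norm_eq_abs,
      abs_of_pos this, inv_mul_cancel₀ this.ne']⟩

/-- The depth `1 - cos θ` of the point of the sphere whose gnomonic coordinate has norm
`r = tan θ`. -/
noncomputable def gnomonicDepth (r : ℝ) : ℝ := 1 - (√(1 + r ^ 2))⁻¹

theorem continuous_gnomonicChart : Continuous (gnomonicChart q) := by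
  have h : Continuous fun v : TangentAt q ↦ (√(1 + ‖v‖ ^ 2))⁻¹ :=
    Continuous.inv₀ (by fun_prop) fun v ↦ by positivity
  exact Continuous.subtype_mk (by fun_prop) _

theorem gnomonicChart_zero : gnomonicChart q 0 = q := by
  ext1
  simp [gnomonicChart]

theorem queryDepth_gnomonicChart (v : TangentAt q) :
    queryDepth q (gnomonicChart q v) = gnomonicDepth ‖v‖ := by
  rw [queryDepth, gnomonicDepth, gnomonicChart, inner_smul_right, inner_add_tangent, mul_one]

theorem finrank_tangentAt_add_one : Module.finrank ℝ (TangentAt q) + 1 = d := by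
  have h := (Submodule.span ℝ {q.1}).finrank_add_finrank_orthogonal
  rwa [finrank_span_singleton (ne_zero_of_mem_unit_sphere q), finrank_euclideanSpace_fin,
    add_comm] at h

theorem measurePreserving_smul_add_tangent :
    MeasurePreserving fun p : ℝ × TangentAt q ↦ p.1 • q.1 + p.2.1 := by
  let line := LinearIsometryEquiv.toSpanUnitSingleton (𝕜 := ℝ) q.1 (norm_eq_of_mem_sphere q)
  have h : MeasurePreserving (Prod.map line (id : TangentAt q → TangentAt q)) :=
    line.measurePreserving.prod (MeasurePreserving.id _)
  exact (Submodule.orthogonalDecomposition _).symm.measurePreserving.comp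
    ((WithLp.volume_preserving_toLp _ _).comp h)

theorem map_smul_volumeIoiPow {T : Type*} [NormedAddCommGroup T] [NormedSpace ℝ T]
    [FiniteDimensional ℝ T] [MeasurableSpace T] [BorelSpace T] (μ : Measure T)
    [μ.IsAddHaarMeasure] :
    ((Measure.volumeIoiPow (Module.finrank ℝ T)).prod μ).map
        (fun p : Set.Ioi (0 : ℝ) × T ↦ (p.1.1, p.1.1 • p.2)) =
      ((volume : Measure ℝ).restrict (Set.Ioi 0)).prod μ := by
  ext S hS
  have hscale : Measurable fun p : Set.Ioi (0 : ℝ) × T ↦ (p.1.1, p.1.1 • p.2) := by fun_prop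
  have hslice (s : Set.Ioi (0 : ℝ)) :
      ENNReal.ofReal (s.1 ^ Module.finrank ℝ T) *
        μ (Prod.mk s ⁻¹' ((fun p : Set.Ioi (0 : ℝ) × T ↦ (p.1.1, p.1.1 • p.2)) ⁻¹' S)) =
      μ (Prod.mk s.1 ⁻¹' S) := by
    have hs : 0 < s.1 ^ Module.finrank ℝ T := pow_pos s.2 _
    calc _ = ENNReal.ofReal (s.1 ^ Module.finrank ℝ T) *
          μ ((s.1 • ·) ⁻¹' (Prod.mk s.1 ⁻¹' S)) := rfl
      _ = _ := by
        rw [Measure.addHaar_preimage_smul μ (ne_of_gt s.2), abs_of_pos (inv_pos.2 hs),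
          ← mul_assoc, ← ENNReal.ofReal_mul hs.le, mul_inv_cancel₀ hs.ne', ENNReal.ofReal_one,
          one_mul]
  rw [Measure.map_apply hscale hS, Measure.prod_apply (hscale hS), Measure.prod_apply hS,
    Measure.volumeIoiPow, lintegral_withDensity_eq_lintegral_mul _ (by fun_prop)
      (measurable_measure_prodMk_left (hscale hS)),
    ← lintegral_subtype_comap measurableSet_Ioi fun s ↦ μ (Prod.mk s ⁻¹' S)]
  exact lintegral_congr hslice

/-- The radius-direction coordinates of the open half-space `0 < ⟨q, ·⟩` in which the gnomonic
chart is the direction. -/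
noncomputable def tangentCone (p : Set.Ioi (0 : ℝ) × TangentAt q) : EuclideanSpace ℝ (Fin d) :=
  p.1.1 • (q.1 + p.2.1)

theorem measurable_tangentCone : Measurable (tangentCone q) := by
  unfold tangentCone
  fun_prop

theorem map_tangentCone :
    ((Measure.volumeIoiPow (Module.finrank ℝ (TangentAt q))).prod volume).map (tangentCone q) =
      volume.restrict {x | 0 < inner ℝ q.1 x} := by
  have hpos : (fun p : ℝ × TangentAt q ↦ p.1 • q.1 + p.2.1) ⁻¹' {x | 0 < inner ℝ q.1 x} =
      Set.Ioi 0 ×ˢ Set.univ := by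
    ext p
    simp [inner_add_right, inner_smul_right, inner_tangent]
  calc _ = (((Measure.volumeIoiPow (Module.finrank ℝ (TangentAt q))).prod volume).map
        (fun p : Set.Ioi (0 : ℝ) × TangentAt q ↦ (p.1.1, p.1.1 • p.2))).map
          (fun p : ℝ × TangentAt q ↦ p.1 • q.1 + p.2.1) := by
        rw [Measure.map_map (by fun_prop) (by fun_prop)]
        congr 1
        ext1 p
        simp [tangentCone, smul_add]
    _ = (volume.restrict (Set.Ioi 0 ×ˢ Set.univ)).map
          (fun p : ℝ × TangentAt q ↦ p.1 • q.1 + p.2.1) := by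
        rw [map_smul_volumeIoiPow, Measure.volume_eq_prod, ← Measure.prod_restrict,
          Measure.restrict_univ]
    _ = _ := by
        rw [← hpos, ← Measure.restrict_map (by fun_prop)
          (measurableSet_lt measurable_const (by fun_prop)),
          (measurePreserving_smul_add_tangent q).map_eq]

theorem mem_Ioo_smul_image_sphere {E : Type*} [NormedAddCommGroup E] [NormedSpace ℝ E]
    {S : Set (Metric.sphere (0 : E) 1)} {x : E} :
    x ∈ Set.Ioo (0 : ℝ) 1 • ((↑) '' S : Set E) ↔
      0 < ‖x‖ ∧ ‖x‖ < 1 ∧ ‖x‖⁻¹ • x ∈ ((↑) '' S : Set E) := by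
  constructor
  · rintro ⟨r, ⟨hr0, hr1⟩, _, ⟨y, hy, rfl⟩, rfl⟩
    have hr : ‖r • (y : E)‖ = r := by
      rw [norm_smul, norm_eq_of_mem_sphere, mul_one, Real.norm_of_nonneg hr0.le]
    change 0 < ‖r • (y : E)‖ ∧ ‖r • (y : E)‖ < 1 ∧ ‖r • (y : E)‖⁻¹ • r • (y : E) ∈ _
    rw [hr, inv_smul_smul₀ hr0.ne']
    exact ⟨hr0, hr1, y, hy, rfl⟩
  · rintro ⟨h0, h1, h⟩
    exact ⟨‖x‖, ⟨h0, h1⟩, _, h, smul_inv_smul₀ h0.ne' x⟩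

theorem measurableSet_Ioo_smul_image_sphere {E : Type*} [NormedAddCommGroup E] [NormedSpace ℝ E]
    [MeasurableSpace E] [BorelSpace E] {S : Set (Metric.sphere (0 : E) 1)}
    (hS : MeasurableSet S) : MeasurableSet (Set.Ioo (0 : ℝ) 1 • ((↑) '' S : Set E)) := by
  have hcoe : MeasurableSet ((↑) '' S : Set E) :=
    (MeasurableEmbedding.subtype_coe Metric.isClosed_sphere.measurableSet).measurableSet_image.2 hS
  have hdir : Measurable fun x : E ↦ ‖x‖⁻¹ • x := by fun_prop
  have h : MeasurableSet {x : E | 0 < ‖x‖ ∧ ‖x‖ < 1 ∧ ‖x‖⁻¹ • x ∈ ((↑) '' S : Set E)} :=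
    (measurableSet_lt measurable_const measurable_norm).inter
      ((measurableSet_lt measurable_norm measurable_const).inter (hdir hcoe))
  convert h using 1
  exact Set.ext fun _ ↦ mem_Ioo_smul_image_sphere

theorem tangentCone_mem_Ioo_smul {S : Set (UnitSphere d)} (p : Set.Ioi (0 : ℝ) × TangentAt q) :
    tangentCone q p ∈ Set.Ioo (0 : ℝ) 1 • ((↑) '' S : Set (EuclideanSpace ℝ (Fin d))) ↔
      p.1.1 < (√(1 + ‖p.2‖ ^ 2))⁻¹ ∧ gnomonicChart q p.2 ∈ S := by
  have hs : 0 < p.1.1 := p.1.2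
  have hv : 0 < √(1 + ‖p.2‖ ^ 2) := by positivity
  have hnorm : ‖tangentCone q p‖ = p.1.1 * √(1 + ‖p.2‖ ^ 2) := by
    rw [tangentCone, norm_smul, norm_add_tangent, Real.norm_of_nonneg hs.le]
  have hdir : ‖tangentCone q p‖⁻¹ • tangentCone q p = gnomonicChart q p.2 := by
    rw [hnorm, tangentCone, gnomonicChart, smul_smul]
    congr 1
    field_simp
  rw [mem_Ioo_smul_image_sphere, hdir, hnorm, Subtype.val_injective.mem_set_image, ← one_div,
    lt_div_iff₀ hv]
  exact and_iff_right (mul_pos hs hv)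

theorem Ioo_smul_inter_hemisphere (S : Set (UnitSphere d)) :
    Set.Ioo (0 : ℝ) 1 • ((↑) '' (S ∩ {x | queryDepth q x < 1}) :
        Set (EuclideanSpace ℝ (Fin d))) =
      Set.Ioo (0 : ℝ) 1 • ((↑) '' S) ∩ {x | 0 < inner ℝ q.1 x} := by
  ext x
  constructor
  · rintro ⟨r, hr, _, ⟨y, ⟨hyS, hy⟩, rfl⟩, rfl⟩
    refine ⟨Set.smul_mem_smul hr ⟨y, hyS, rfl⟩, ?_⟩
    change 0 < inner ℝ q.1 (r • y.1)
    rw [inner_smul_right]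
    exact mul_pos hr.1 (sub_lt_self_iff _ |>.1 hy)
  · rintro ⟨⟨r, hr, _, ⟨y, hyS, rfl⟩, rfl⟩, hpos⟩
    change 0 < inner ℝ q.1 (r • y.1) at hpos
    rw [inner_smul_right] at hpos
    exact Set.smul_mem_smul hr
      ⟨y, ⟨hyS, sub_lt_self _ (pos_of_mul_pos_right hpos hr.1.le)⟩, rfl⟩

theorem natCast_mul_volumeIoiPow_slice (S : Set (UnitSphere d)) (v : TangentAt q) :
    d * Measure.volumeIoiPow (Module.finrank ℝ (TangentAt q))
      ((fun s ↦ (s, v)) ⁻¹' (tangentCone q ⁻¹' (Set.Ioo (0 : ℝ) 1 • ((↑) '' S)))) =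
    (gnomonicChart q ⁻¹' S).indicator
      (fun v ↦ ENNReal.ofReal ((√(1 + ‖v‖ ^ 2))⁻¹ ^ d)) v := by
  have hd : (d : ℝ) ≠ 0 := by
    rw [← finrank_tangentAt_add_one q]
    positivity
  have hv : 0 < (√(1 + ‖v‖ ^ 2))⁻¹ := by positivity
  by_cases hvS : v ∈ gnomonicChart q ⁻¹' S
  · have hIio : (fun s ↦ (s, v)) ⁻¹' (tangentCone q ⁻¹' (Set.Ioo (0 : ℝ) 1 • ((↑) '' S))) =
        Set.Iio (⟨_, hv⟩ : Set.Ioi (0 : ℝ)) := by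
      ext s
      exact (tangentCone_mem_Ioo_smul q (s, v)).trans (and_iff_left hvS)
    rw [hIio, Measure.volumeIoiPow_apply_Iio, Set.indicator_of_mem hvS, ← ENNReal.ofReal_natCast,
      ← ENNReal.ofReal_mul (by positivity), finrank_tangentAt_add_one, ← Nat.cast_add_one,
      finrank_tangentAt_add_one, mul_div_cancel₀ _ hd]
  · have hempty : (fun s ↦ (s, v)) ⁻¹' (tangentCone q ⁻¹' (Set.Ioo (0 : ℝ) 1 • ((↑) '' S))) =
        ∅ := by
      ext s
      exact iff_of_false (fun h ↦ hvS ((tangentCone_mem_Ioo_smul q (s, v)).1 h).2) (by simp)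
    rw [hempty, measure_empty, mul_zero, Set.indicator_of_notMem hvS]

theorem surfaceMeasure_restrict_hemisphere :
    (surfaceMeasure d).restrict {x | queryDepth q x < 1} =
      ((volume : Measure (TangentAt q)).withDensity
        fun v ↦ ENNReal.ofReal ((√(1 + ‖v‖ ^ 2))⁻¹ ^ d)).map (gnomonicChart q) := by
  ext S hS
  have hH : MeasurableSet {x | queryDepth q x < 1} :=
    measurableSet_lt (continuous_queryDepth q).measurable measurable_const
  have hchart := (continuous_gnomonicChart q).measurable
  have hcone := measurableSet_Ioo_smul_image_sphere hS
  rw [Measure.restrict_apply hS, Measure.map_apply hchart hS, withDensity_apply _ (hchart hS),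
    surfaceMeasure, Measure.toSphere_apply' _ (hS.inter hH), Ioo_smul_inter_hemisphere,
    ← Measure.restrict_apply hcone, ← map_tangentCone,
    Measure.map_apply (measurable_tangentCone q) hcone,
    Measure.prod_apply_symm (measurable_tangentCone q hcone), finrank_euclideanSpace_fin,
    ← lintegral_indicator (hchart hS), ← lintegral_const_mul]
  · exact lintegral_congr (natCast_mul_volumeIoiPow_slice q S)
  · exact measurable_measure_prodMk_right (measurable_tangentCone q hcone)

end Gnomonic

theorem gnomonicDepth_eq_div (r : ℝ) :
    gnomonicDepth r = r ^ 2 / (√(1 + r ^ 2) * (√(1 + r ^ 2) + 1)) := by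
  have hsq : √(1 + r ^ 2) ^ 2 = 1 + r ^ 2 := Real.sq_sqrt (by positivity)
  rw [gnomonicDepth, eq_div_iff (by positivity)]
  field_simp
  linear_combination hsq

theorem le_gnomonicDepth {r : ℝ} (hr : |r| ≤ 1) : r ^ 2 / 4 ≤ gnomonicDepth r := by
  have hr2 : r ^ 2 ≤ 1 := (sq_le_one_iff_abs_le_one r).2 hr
  have hsq : √(1 + r ^ 2) ^ 2 = 1 + r ^ 2 := Real.sq_sqrt (by positivity)
  have hw : √(1 + r ^ 2) ≤ 3 / 2 := Real.sqrt_le_iff.2 ⟨by norm_num, by linarith⟩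
  have hw' : √(1 + r ^ 2) * (√(1 + r ^ 2) + 1) ≤ 4 := by nlinarith
  rw [gnomonicDepth_eq_div]
  gcongr

theorem strictMonoOn_gnomonicDepth : StrictMonoOn gnomonicDepth (Set.Ici 0) := by
  intro r (hr : 0 ≤ r) r' _ hlt
  unfold gnomonicDepth
  gcongr

theorem gnomonicDepth_zero : gnomonicDepth 0 = 0 := by simp [gnomonicDepth]

theorem gnomonicDepth_lt_one (r : ℝ) : gnomonicDepth r < 1 :=
  sub_lt_self _ (by positivity)

theorem continuous_gnomonicDepth : Continuous gnomonicDepth :=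
  continuous_const.sub (Continuous.inv₀ (by fun_prop) fun r ↦ by positivity)

theorem tendsto_sq_mul_gnomonicDepth {ι : Type*} {l : Filter ι} {s : ι → ℝ}
    (hs : Tendsto s l atTop) (r : ℝ) :
    Tendsto (fun i ↦ s i ^ 2 * gnomonicDepth ((s i)⁻¹ * r)) l (𝓝 (r ^ 2 / 2)) := by
  have hw : Continuous fun x : ℝ ↦ r ^ 2 / (√(1 + (x * r) ^ 2) * (√(1 + (x * r) ^ 2) + 1)) :=
    Continuous.div (by fun_prop) (by fun_prop) fun x ↦ by positivity
  have h := (hw.tendsto 0).comp hs.inv_tendsto_atTop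
  norm_num at h
  refine h.congr' ?_
  filter_upwards [hs.eventually_gt_atTop 0] with i hi
  rw [gnomonicDepth_eq_div]
  simp only [Function.comp_apply, Pi.inv_apply]
  field_simp

theorem integrable_exp_neg_mul_norm_sq {T : Type*} [NormedAddCommGroup T] [InnerProductSpace ℝ T]
    [FiniteDimensional ℝ T] [MeasurableSpace T] [BorelSpace T] {b : ℝ} (hb : 0 < b) :
    Integrable fun u : T ↦ Real.exp (-b * ‖u‖ ^ 2) := by
  refine .of_integral_ne_zero ?_
  rw [GaussianFourier.integral_rexp_neg_mul_sq_norm hb]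
  positivity

theorem tendsto_pow_mul_exp_neg_sq_mul {ι : Type*} {l : Filter ι} {s : ι → ℝ}
    (hs : Tendsto s l atTop) (m : ℕ) {b : ℝ} (hb : 0 < b) :
    Tendsto (fun i ↦ s i ^ m * Real.exp (-(s i ^ 2 * b))) l (𝓝 0) := by
  have h := ((Real.tendsto_pow_mul_exp_neg_atTop_nhds_zero m).comp
    (((tendsto_pow_atTop two_ne_zero).comp hs).atTop_mul_const hb)).const_mul (b ^ m)⁻¹
  rw [mul_zero] at h
  refine squeeze_zero' ?_ ?_ h
  · filter_upwards [hs.eventually_ge_atTop 0] with i hi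
    positivity
  · filter_upwards [hs.eventually_ge_atTop 1] with i hi
    have hle : s i ^ m ≤ (s i ^ 2) ^ m := by
      gcongr
      exact le_self_pow₀ hi two_ne_zero
    calc s i ^ m * Real.exp (-(s i ^ 2 * b)) ≤ (s i ^ 2) ^ m * Real.exp (-(s i ^ 2 * b)) := by
          gcongr
      _ = _ := by
          simp only [Function.comp_apply, mul_pow]
          field_simp

theorem measurableSet_gnomonicDepth_norm_le {T : Type*} [NormedAddCommGroup T] [MeasurableSpace T]
    [OpensMeasurableSpace T] (a : ℝ) : MeasurableSet {v : T | gnomonicDepth ‖v‖ ≤ a} :=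
  measurableSet_le (continuous_gnomonicDepth.measurable.comp measurable_norm) measurable_const

/-- A measure `μ` with depth function `D` which, on the cap `D < 1`, is the image under the chart
`γ` of a measure with density `h`, the depth of `γ v` being `gnomonicDepth ‖v‖`. The density is
only assumed to be continuous at the centre of the chart. -/
structure IsGnomonicModel {S T : Type*} [MeasurableSpace S] [NormedAddCommGroup T]
    [InnerProductSpace ℝ T] [FiniteDimensional ℝ T] [MeasurableSpace T] [BorelSpace T]
    (μ : Measure S) (D : S → ℝ) (γ : T → S) (h : T → ℝ) : Prop where
  measurable_depth : Measurable D
  depth_nonneg : ∀ x, 0 ≤ D x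
  measurable_chart : Measurable γ
  depth_chart : ∀ v, D (γ v) = gnomonicDepth ‖v‖
  measurable_density : Measurable h
  continuousAt_density : ContinuousAt h 0
  density_nonneg : ∀ v, 0 ≤ h v
  restrict_eq : μ.restrict {x | D x < 1} =
    (volume.withDensity fun v ↦ ENNReal.ofReal (h v)).map γ

namespace IsGnomonicModel

variable {S T : Type*} [MeasurableSpace S] [NormedAddCommGroup T] [InnerProductSpace ℝ T]
  [FiniteDimensional ℝ T] [MeasurableSpace T] [BorelSpace T] {μ : Measure S} {D : S → ℝ}
  {γ : T → S} {h : T → ℝ}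

theorem measurableSet_cap (H : IsGnomonicModel μ D γ h) (a : ℝ) : MeasurableSet {x | D x ≤ a} :=
  measurableSet_le H.measurable_depth measurable_const

theorem setIntegral_cap (H : IsGnomonicModel μ D γ h) {a : ℝ} (ha : a < 1) {Φ : S → ℝ}
    (hΦ : Measurable Φ) :
    ∫ x in {x | D x ≤ a}, Φ x ∂μ =
      ∫ v in {v | gnomonicDepth ‖v‖ ≤ a}, h v * Φ (γ v) := by
  have hA := H.measurableSet_cap a
  have hsub : {x | D x ≤ a} ∩ {x | D x < 1} = {x | D x ≤ a} :=
    Set.inter_eq_left.2 fun x (hx : D x ≤ a) ↦ hx.trans_lt ha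
  have hpre : γ ⁻¹' {x | D x ≤ a} = {v | gnomonicDepth ‖v‖ ≤ a} := by
    ext v
    simp [H.depth_chart]
  calc ∫ x in {x | D x ≤ a}, Φ x ∂μ
      = ∫ x in {x | D x ≤ a}, Φ x ∂(μ.restrict {x | D x < 1}) := by
        rw [Measure.restrict_restrict hA, hsub]
    _ = ∫ v in {v | gnomonicDepth ‖v‖ ≤ a}, Φ (γ v)
          ∂(volume.withDensity fun v ↦ ENNReal.ofReal (h v)) := by
        rw [H.restrict_eq, setIntegral_map hA hΦ.aestronglyMeasurable
          H.measurable_chart.aemeasurable, hpre]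
    _ = _ := by
        rw [setIntegral_withDensity_eq_setIntegral_toReal_smul
          H.measurable_density.ennreal_ofReal (by simp) _ (measurableSet_gnomonicDepth_norm_le a)]
        simp only [ENNReal.toReal_ofReal (H.density_nonneg _), smul_eq_mul]

theorem exists_cap_density_le (H : IsGnomonicModel μ D γ h) :
    ∃ a > 0, a < 1 ∧ ∃ B ≥ 0, ∀ v, gnomonicDepth ‖v‖ ≤ a → ‖v‖ ≤ 1 ∧ h v ≤ B := by
  obtain ⟨δ, hδ, hB⟩ := Metric.eventually_nhds_iff_ball.1
    (H.continuousAt_density.eventually_le_const (lt_add_one (h 0)))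
  have hr : 0 < min (δ / 2) 1 := by positivity
  refine ⟨gnomonicDepth (min (δ / 2) 1),
    gnomonicDepth_zero ▸ strictMonoOn_gnomonicDepth Set.self_mem_Ici hr.le hr,
    gnomonicDepth_lt_one _, h 0 + 1, by linarith [H.density_nonneg 0], fun v hv ↦ ?_⟩
  have hv' := (strictMonoOn_gnomonicDepth.le_iff_le (norm_nonneg v) hr.le).1 hv
  exact ⟨hv'.trans (min_le_right _ _),
    hB v (by simpa using (hv'.trans (min_le_left _ _)).trans_lt (half_lt_self hδ))⟩

theorem depth_chart_smul (H : IsGnomonicModel μ D γ h) {s : ℝ} (hs : 0 < s) (u : T) :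
    D (γ (s⁻¹ • u)) = gnomonicDepth (s⁻¹ * ‖u‖) := by
  rw [H.depth_chart, norm_smul, norm_inv, Real.norm_of_nonneg hs.le]

theorem tendsto_sq_mul_depth (H : IsGnomonicModel μ D γ h) {ι : Type*} {l : Filter ι} {s : ι → ℝ}
    (hs : Tendsto s l atTop) (u : T) :
    Tendsto (fun i ↦ s i ^ 2 * D (γ ((s i)⁻¹ • u))) l (𝓝 (‖u‖ ^ 2 / 2)) := by
  refine (tendsto_sq_mul_gnomonicDepth hs ‖u‖).congr' ?_
  filter_upwards [hs.eventually_gt_atTop 0] with i hi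
  rw [H.depth_chart_smul hi]

theorem norm_sq_le_sq_mul_depth (H : IsGnomonicModel μ D γ h) {s : ℝ} (hs : 0 < s) {u : T}
    (hu : ‖s⁻¹ • u‖ ≤ 1) : ‖u‖ ^ 2 / 4 ≤ s ^ 2 * D (γ (s⁻¹ • u)) := by
  calc ‖u‖ ^ 2 / 4 = s ^ 2 * (‖s⁻¹ • u‖ ^ 2 / 4) := by
        rw [norm_smul, norm_inv, Real.norm_of_nonneg hs.le]
        field_simp
    _ ≤ _ := by
        rw [H.depth_chart]
        gcongr
        exact le_gnomonicDepth (by rwa [abs_norm])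

section ScaledIntegral

variable {ι : Type*} {l : Filter ι} {s : ι → ℝ} {Φ : ι → S → ℝ} {c : ℝ}

theorem norm_indicator_cap_le (H : IsGnomonicModel μ D γ h) (hc : 0 ≤ c) {s : ℝ} (hs : 0 < s)
    {Ψ : S → ℝ} (hΨ : ∀ x, |Ψ x| ≤ c * Real.exp (-(s ^ 2 * D x / 2))) {a B : ℝ} (hB : 0 ≤ B)
    (hcap : ∀ v, gnomonicDepth ‖v‖ ≤ a → ‖v‖ ≤ 1 ∧ h v ≤ B) (u : T) :
    ‖{v | gnomonicDepth ‖v‖ ≤ a}.indicator (fun v ↦ h v * Ψ (γ v)) (s⁻¹ • u)‖ ≤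
      B * c * Real.exp (-(1 / 8) * ‖u‖ ^ 2) := by
  by_cases hu : s⁻¹ • u ∈ {v : T | gnomonicDepth ‖v‖ ≤ a}
  · obtain ⟨hu1, huB⟩ := hcap _ hu
    have hdepth := H.norm_sq_le_sq_mul_depth hs hu1
    rw [Set.indicator_of_mem hu, norm_mul, Real.norm_of_nonneg (H.density_nonneg _), mul_assoc]
    gcongr
    refine (hΨ _).trans ?_
    gcongr
    linarith
  · rw [Set.indicator_of_notMem hu, norm_zero]
    positivity

theorem tendsto_scaled_setIntegral_cap (H : IsGnomonicModel μ D γ h) [l.IsCountablyGenerated]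
    (hs : Tendsto s l atTop) (hc : 0 ≤ c) (hm : ∀ᶠ i in l, Measurable (Φ i))
    (hb : ∀ᶠ i in l, ∀ x, |Φ i x| ≤ c * Real.exp (-(s i ^ 2 * D x / 2))) {φ : T → ℝ}
    (hlim : ∀ᵐ u : T, Tendsto (fun i ↦ Φ i (γ ((s i)⁻¹ • u))) l (𝓝 (φ u)))
    {a B : ℝ} (ha : 0 < a) (ha1 : a < 1) (hB : 0 ≤ B)
    (hcap : ∀ v, gnomonicDepth ‖v‖ ≤ a → ‖v‖ ≤ 1 ∧ h v ≤ B) :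
    Tendsto (fun i ↦ s i ^ Module.finrank ℝ T * ∫ x in {x | D x ≤ a}, Φ i x ∂μ) l
      (𝓝 (h 0 * ∫ u, φ u)) := by
  let G (i : ι) : T → ℝ := {v | gnomonicDepth ‖v‖ ≤ a}.indicator fun v ↦ h v * Φ i (γ v)
  have hG : Tendsto (fun i ↦ ∫ u, G i ((s i)⁻¹ • u)) l (𝓝 (∫ u, h 0 * φ u)) := by
    refine tendsto_integral_filter_of_dominated_convergence
      (fun u ↦ B * c * Real.exp (-(1 / 8) * ‖u‖ ^ 2)) ?_ ?_
      ((integrable_exp_neg_mul_norm_sq (by norm_num)).const_mul _) ?_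
    · filter_upwards [hm] with i hi
      have hGm : Measurable (G i) :=
        (H.measurable_density.mul (hi.comp H.measurable_chart)).indicator
          (measurableSet_gnomonicDepth_norm_le a)
      exact (hGm.comp (measurable_const_smul _)).aestronglyMeasurable
    · filter_upwards [hb, hs.eventually_gt_atTop 0] with i hi hsi
      exact ae_of_all _ fun u ↦ H.norm_indicator_cap_le hc hsi hi hB hcap u
    · filter_upwards [hlim] with u hu
      have h0 : Tendsto (fun i ↦ (s i)⁻¹ • u) l (𝓝 0) := by
        simpa using hs.inv_tendsto_atTop.smul_const u
      have hdepth : Tendsto (fun i ↦ gnomonicDepth ‖(s i)⁻¹ • u‖) l (𝓝 0) := by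
        simpa [gnomonicDepth_zero, Function.comp_def] using
          (continuous_gnomonicDepth.tendsto _).comp h0.norm
      refine ((H.continuousAt_density.tendsto.comp h0).mul hu).congr' ?_
      filter_upwards [hdepth.eventually_le_const ha] with i hi
      simp only [G]
      rw [Set.indicator_of_mem (by exact hi), Function.comp_apply]
  rw [← integral_const_mul]
  refine hG.congr' ?_
  filter_upwards [hm, hs.eventually_gt_atTop 0] with i hi hsi
  rw [H.setIntegral_cap ha1 hi, ← integral_indicator (measurableSet_gnomonicDepth_norm_le a),
    Measure.integral_comp_smul, inv_pow, inv_inv,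
    abs_of_pos (by positivity), smul_eq_mul]

theorem tendsto_scaled_setIntegral_compl_cap [IsFiniteMeasure μ] (hs : Tendsto s l atTop)
    (hc : 0 ≤ c) (hb : ∀ᶠ i in l, ∀ x, |Φ i x| ≤ c * Real.exp (-(s i ^ 2 * D x / 2)))
    (m : ℕ) {a : ℝ} (ha : 0 < a) :
    Tendsto (fun i ↦ s i ^ m * ∫ x in {x | D x ≤ a}ᶜ, Φ i x ∂μ) l (𝓝 0) := by
  have h0 := (tendsto_pow_mul_exp_neg_sq_mul hs m (half_pos ha)).const_mul (c * μ.real Set.univ)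
  rw [mul_zero] at h0
  refine squeeze_zero_norm' ?_ h0
  filter_upwards [hb, hs.eventually_ge_atTop 0] with i hi hsi
  have hfar (x : S) (hx : x ∈ {x | D x ≤ a}ᶜ) :
      ‖Φ i x‖ ≤ c * Real.exp (-(s i ^ 2 * (a / 2))) := by
    have hx : a ≤ D x := le_of_lt (by simpa using hx)
    refine (hi x).trans ?_
    rw [mul_div_assoc]
    gcongr
  calc ‖s i ^ m * ∫ x in {x | D x ≤ a}ᶜ, Φ i x ∂μ‖
      ≤ s i ^ m * (c * Real.exp (-(s i ^ 2 * (a / 2))) * μ.real {x | D x ≤ a}ᶜ) := by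
        rw [norm_mul, norm_pow, Real.norm_of_nonneg hsi]
        gcongr
        exact norm_setIntegral_le_of_norm_le_const (measure_lt_top _ _) hfar
    _ ≤ s i ^ m * (c * Real.exp (-(s i ^ 2 * (a / 2))) * μ.real Set.univ) := by
        gcongr
        · finiteness
        · exact Set.subset_univ _
    _ = _ := by ring

theorem tendsto_scaled_integral (H : IsGnomonicModel μ D γ h) [IsFiniteMeasure μ]
    [l.IsCountablyGenerated] (hs : Tendsto s l atTop) (hc : 0 ≤ c)
    (hm : ∀ᶠ i in l, Measurable (Φ i))
    (hb : ∀ᶠ i in l, ∀ x, |Φ i x| ≤ c * Real.exp (-(s i ^ 2 * D x / 2))) {φ : T → ℝ}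
    (hlim : ∀ᵐ u : T, Tendsto (fun i ↦ Φ i (γ ((s i)⁻¹ • u))) l (𝓝 (φ u))) :
    Tendsto (fun i ↦ s i ^ Module.finrank ℝ T * ∫ x, Φ i x ∂μ) l (𝓝 (h 0 * ∫ u, φ u)) := by
  obtain ⟨a, ha, ha1, B, hB, hcap⟩ := H.exists_cap_density_le
  have hsum := (H.tendsto_scaled_setIntegral_cap hs hc hm hb hlim ha ha1 hB hcap).add
    (tendsto_scaled_setIntegral_compl_cap (μ := μ) hs hc hb (Module.finrank ℝ T) ha)
  rw [add_zero] at hsum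
  refine hsum.congr' ?_
  filter_upwards [hb, hm] with i hi hmi
  have hint : Integrable (Φ i) μ := by
    refine .of_bound hmi.aestronglyMeasurable c (ae_of_all _ fun x ↦ (hi x).trans ?_)
    have := H.depth_nonneg x
    exact mul_le_of_le_one_right hc (Real.exp_le_one_iff.2 (neg_nonpos.2 (by positivity)))
  rw [← integral_add_compl (H.measurableSet_cap a) hint, mul_add]

end ScaledIntegral

end IsGnomonicModel

/-- The volume of the ball of points whose limiting depth `‖u‖² / 2` is at most `1`. -/
noncomputable def unitDepthVolume (T : Type*) [NormedAddCommGroup T] [InnerProductSpace ℝ T]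
    [FiniteDimensional ℝ T] [MeasurableSpace T] [BorelSpace T] : ℝ :=
  volume.real (Metric.closedBall (0 : T) √2)

section UnitDepthVolume

variable {T : Type*} [NormedAddCommGroup T] [InnerProductSpace ℝ T] [FiniteDimensional ℝ T]
  [MeasurableSpace T] [BorelSpace T]

theorem unitDepthVolume_pos : 0 < unitDepthVolume T :=
  ENNReal.toReal_pos (Metric.measure_closedBall_pos _ _ (by positivity)).ne'
    measure_closedBall_lt_top.ne

theorem volume_real_closedBall {L : ℝ} (hL : 0 ≤ L) :
    volume.real (Metric.closedBall (0 : T) L) =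
      (L / √2) ^ Module.finrank ℝ T * unitDepthVolume T := by
  rw [unitDepthVolume, Measure.addHaar_real_closedBall _ _ hL,
    Measure.addHaar_real_closedBall _ _ (Real.sqrt_nonneg 2), div_pow]
  field_simp

end UnitDepthVolume

namespace IsGnomonicModel

variable {S T : Type*} [MeasurableSpace S] [NormedAddCommGroup T] [InnerProductSpace ℝ T]
  [FiniteDimensional ℝ T] [MeasurableSpace T] [BorelSpace T] {μ : Measure S} {D : S → ℝ}
  {γ : T → S} {h : T → ℝ}

section ShrinkingCap

variable {ι : Type*} {l : Filter ι} {s a : ι → ℝ} {L : ℝ}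

theorem eventually_depth_le_iff (H : IsGnomonicModel μ D γ h) (hs : Tendsto s l atTop)
    (ha : Tendsto (fun i ↦ s i ^ 2 * a i) l (𝓝 (L ^ 2 / 2))) (hL : 0 ≤ L) {u : T} (hu : ‖u‖ ≠ L) :
    ∀ᶠ i in l, D (γ ((s i)⁻¹ • u)) ≤ a i ↔ u ∈ Metric.closedBall 0 L := by
  have hD := H.tendsto_sq_mul_depth hs u
  rw [mem_closedBall_zero_iff]
  rcases hu.lt_or_gt with hlt | hgt
  · filter_upwards [hD.eventually_lt ha (by gcongr), hs.eventually_gt_atTop 0] with i hi hsi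
    exact iff_of_true (lt_of_mul_lt_mul_left hi (by positivity)).le hlt.le
  · filter_upwards [ha.eventually_lt hD (by gcongr), hs.eventually_gt_atTop 0] with i hi hsi
    exact iff_of_false (lt_of_mul_lt_mul_left hi (by positivity)).not_ge hgt.not_ge

theorem tendsto_scaled_setIntegral_shrinking_cap (H : IsGnomonicModel μ D γ h)
    [Nontrivial T] [IsFiniteMeasure μ] [l.IsCountablyGenerated] (hs : Tendsto s l atTop)
    (ha : Tendsto (fun i ↦ s i ^ 2 * a i) l (𝓝 (L ^ 2 / 2))) (hL : 0 ≤ L) {g : ι → S → ℝ} {M : ℝ}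
    (hM : 0 ≤ M) (hgm : ∀ i, Measurable (g i)) (hgM : ∀ᶠ i in l, ∀ x, |g i x| ≤ M) {φ : T → ℝ}
    (hg : ∀ u, Tendsto (fun i ↦ g i (γ ((s i)⁻¹ • u))) l (𝓝 (φ u))) :
    Tendsto (fun i ↦ s i ^ Module.finrank ℝ T * ∫ x in {x | D x ≤ a i}, g i x ∂μ) l
      (𝓝 (h 0 * ∫ u in Metric.closedBall 0 L, φ u)) := by
  simp_rw [← integral_indicator (H.measurableSet_cap _),
    ← integral_indicator Metric.isClosed_closedBall.measurableSet]
  refine H.tendsto_scaled_integral hs (c := M * Real.exp ((L ^ 2 / 2 + 1) / 2)) (by positivity)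
    (.of_forall fun i ↦ (hgm i).indicator (H.measurableSet_cap _)) ?_ ?_
  · filter_upwards [hgM, ha.eventually_le_const (lt_add_one _)] with i hi hai x
    by_cases hx : x ∈ {x | D x ≤ a i}
    · have hdepth : s i ^ 2 * D x ≤ L ^ 2 / 2 + 1 := le_trans (by gcongr; exact hx) hai
      rw [Set.indicator_of_mem hx, mul_assoc, ← Real.exp_add]
      refine (hi x).trans (le_mul_of_one_le_right hM (Real.one_le_exp ?_))
      linarith
    · rw [Set.indicator_of_notMem hx, abs_zero]
      positivity
  · filter_upwards [measure_eq_zero_iff_ae_notMem.1 (Measure.addHaar_sphere volume (0 : T) L)]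
      with u hu
    rw [mem_sphere_zero_iff_norm] at hu
    by_cases huL : u ∈ Metric.closedBall 0 L
    · rw [Set.indicator_of_mem huL]
      refine (hg u).congr' ?_
      filter_upwards [H.eventually_depth_le_iff hs ha hL hu] with i hi
      rw [Set.indicator_of_mem (by exact hi.2 huL)]
    · rw [Set.indicator_of_notMem huL]
      refine tendsto_const_nhds.congr' ?_
      filter_upwards [H.eventually_depth_le_iff hs ha hL hu] with i hi
      rw [Set.indicator_of_notMem (by exact mt hi.1 huL)]

theorem tendsto_scaled_cdf (H : IsGnomonicModel μ D γ h) [Nontrivial T] [IsFiniteMeasure μ]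
    [l.IsCountablyGenerated] (hs : Tendsto s l atTop)
    (ha : Tendsto (fun i ↦ s i ^ 2 * a i) l (𝓝 (L ^ 2 / 2))) (hL : 0 ≤ L) :
    Tendsto (fun i ↦ s i ^ Module.finrank ℝ T * μ.real {x | D x ≤ a i}) l
      (𝓝 (h 0 * volume.real (Metric.closedBall (0 : T) L))) := by
  simpa using H.tendsto_scaled_setIntegral_shrinking_cap hs ha hL (g := fun _ _ ↦ 1) zero_le_one
    (fun _ ↦ measurable_const) (.of_forall fun _ _ ↦ abs_one.le) fun _ ↦ tendsto_const_nhds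

end ShrinkingCap

/-- The limit of `μ {D ≤ t} / t ^ (m / 2)` as `t → 0+`, where `m` is the dimension of the chart. -/
noncomputable def intensity (h : T → ℝ) : ℝ := h 0 * unitDepthVolume T

theorem intensity_pos (h0 : 0 < h 0) : 0 < intensity h := mul_pos h0 unitDepthVolume_pos

theorem tendsto_cdf_mul_rpow (H : IsGnomonicModel μ D γ h) [Nontrivial T] [IsFiniteMeasure μ] :
    Tendsto (fun t : ℝ ↦ μ.real {x | D x ≤ t} * t ^ (-((Module.finrank ℝ T : ℝ) / 2))) (𝓝[>] 0)
      (𝓝 (intensity h)) := by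
  have hsqrt : Tendsto (√·) (𝓝[>] 0) (𝓝[>] 0) := by
    refine tendsto_nhdsWithin_iff.2 ⟨?_, ?_⟩
    · simpa using (Real.continuous_sqrt.tendsto 0).mono_left nhdsWithin_le_nhds
    · filter_upwards [self_mem_nhdsWithin] with t ht
      exact Real.sqrt_pos.2 ht
  have hs : Tendsto (fun t : ℝ ↦ (√t)⁻¹) (𝓝[>] 0) atTop := tendsto_inv_nhdsGT_zero.comp hsqrt
  have ha : Tendsto (fun t : ℝ ↦ (√t)⁻¹ ^ 2 * t) (𝓝[>] 0) (𝓝 (√2 ^ 2 / 2)) := by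
    refine tendsto_const_nhds.congr' ?_
    filter_upwards [self_mem_nhdsWithin] with t (ht : 0 < t)
    rw [inv_pow, Real.sq_sqrt ht.le, Real.sq_sqrt zero_le_two, div_self two_ne_zero,
      inv_mul_cancel₀ ht.ne']
  refine (H.tendsto_scaled_cdf hs ha (Real.sqrt_nonneg 2)).congr' ?_
  filter_upwards [self_mem_nhdsWithin] with t (ht : 0 < t)
  rw [mul_comm, Real.rpow_neg ht.le, inv_pow, Real.sqrt_eq_rpow, ← Real.rpow_natCast,
    ← Real.rpow_mul ht.le, one_div_mul_eq_div]

section Sequence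

variable {s : ℕ → ℝ}

theorem tendsto_nat_mul_of_scaled (h0 : 0 < h 0)
    (hsn : ∀ n : ℕ, s n ^ Module.finrank ℝ T = intensity h * n) {I : ℕ → ℝ} {J : ℝ}
    (hI : Tendsto (fun n ↦ s n ^ Module.finrank ℝ T * I n) atTop (𝓝 (h 0 * J))) :
    Tendsto (fun n : ℕ ↦ n * I n) atTop (𝓝 ((unitDepthVolume T)⁻¹ * J)) := by
  have hlim := hI.const_mul (intensity h)⁻¹
  rw [← mul_assoc, show (intensity h)⁻¹ * h 0 = (unitDepthVolume T)⁻¹ by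
    rw [intensity, mul_inv_rev, inv_mul_cancel_right₀ h0.ne']] at hlim
  refine hlim.congr fun n ↦ ?_
  rw [hsn, mul_assoc, inv_mul_cancel_left₀ (intensity_pos h0).ne']

theorem tendsto_nat_mul_cdf (H : IsGnomonicModel μ D γ h) [Nontrivial T] [IsFiniteMeasure μ]
    (h0 : 0 < h 0) (hs : Tendsto s atTop atTop)
    (hsn : ∀ n : ℕ, s n ^ Module.finrank ℝ T = intensity h * n) {a : ℕ → ℝ} {L : ℝ}
    (ha : Tendsto (fun n ↦ s n ^ 2 * a n) atTop (𝓝 (L ^ 2 / 2))) (hL : 0 ≤ L) :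
    Tendsto (fun n : ℕ ↦ n * μ.real {x | D x ≤ a n}) atTop
      (𝓝 ((L / √2) ^ Module.finrank ℝ T)) := by
  have hlim := tendsto_nat_mul_of_scaled h0 hsn (H.tendsto_scaled_cdf hs ha hL)
  rwa [volume_real_closedBall hL, mul_comm, mul_inv_cancel_right₀ unitDepthVolume_pos.ne'] at hlim

variable [IsProbabilityMeasure μ]

theorem measureReal_depth_gt (H : IsGnomonicModel μ D γ h) (a : ℝ) :
    μ.real {y | a < D y} = 1 - μ.real {y | D y ≤ a} := by
  rw [← probReal_compl_eq_one_sub (H.measurableSet_cap a)]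
  simp only [Set.compl_ofPred, not_le]

theorem tendsto_depth_gt_pow (H : IsGnomonicModel μ D γ h) [Nontrivial T] (h0 : 0 < h 0)
    (hs : Tendsto s atTop atTop) (hsn : ∀ n : ℕ, s n ^ Module.finrank ℝ T = intensity h * n)
    {a : ℕ → ℝ} {L : ℝ} (ha : Tendsto (fun n ↦ s n ^ 2 * a n) atTop (𝓝 (L ^ 2 / 2)))
    (hL : 0 ≤ L) :
    Tendsto (fun n : ℕ ↦ μ.real {x | a n < D x} ^ n) atTop
      (𝓝 (Real.exp (-(L / √2) ^ Module.finrank ℝ T))) := by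
  have hlim := (H.tendsto_nat_mul_cdf h0 hs hsn ha hL).neg
  simp_rw [← mul_neg] at hlim
  simpa only [H.measureReal_depth_gt, sub_eq_add_neg] using
    Real.tendsto_one_add_pow_exp_of_tendsto hlim

theorem tendsto_depth_gt_pow_sub_one (H : IsGnomonicModel μ D γ h) [Nontrivial T] (h0 : 0 < h 0)
    (hs : Tendsto s atTop atTop) (hsn : ∀ n : ℕ, s n ^ Module.finrank ℝ T = intensity h * n)
    {a : ℕ → ℝ} {L : ℝ} (ha : Tendsto (fun n ↦ s n ^ 2 * a n) atTop (𝓝 (L ^ 2 / 2)))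
    (hL : 0 ≤ L) :
    Tendsto (fun n : ℕ ↦ μ.real {x | a n < D x} ^ (n - 1)) atTop
      (𝓝 (Real.exp (-(L / √2) ^ Module.finrank ℝ T))) := by
  have hone : Tendsto (fun n ↦ μ.real {x | a n < D x}) atTop (𝓝 1) := by
    have hcdf := ((H.tendsto_nat_mul_cdf h0 hs hsn ha hL).mul
      tendsto_inv_atTop_nhds_zero_nat).const_sub 1
    rw [mul_zero, sub_zero] at hcdf
    refine hcdf.congr' ?_
    filter_upwards [eventually_ne_atTop 0] with n hn
    rw [H.measureReal_depth_gt, mul_comm, inv_mul_cancel_left₀ (Nat.cast_ne_zero.2 hn)]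
  have hdiv := (H.tendsto_depth_gt_pow h0 hs hsn ha hL).div hone one_ne_zero
  rw [div_one] at hdiv
  refine hdiv.congr' ?_
  filter_upwards [eventually_ne_atTop 0, hone.eventually_ne one_ne_zero] with n hn hne
  rw [Pi.div_apply, ← pow_sub_one_mul hn, mul_div_cancel_right₀ _ hne]

theorem measurable_measureReal_depth_gt (H : IsGnomonicModel μ D γ h) :
    Measurable fun x ↦ μ.real {y | D x < D y} :=
  (measurable_measure_prodMk_left (measurableSet_lt (H.measurable_depth.comp measurable_fst)
    (H.measurable_depth.comp measurable_snd))).ennreal_toReal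

theorem tendsto_nearest_term (H : IsGnomonicModel μ D γ h) [Nontrivial T] (h0 : 0 < h 0)
    (hs : Tendsto s atTop atTop) (hsn : ∀ n : ℕ, s n ^ Module.finrank ℝ T = intensity h * n)
    {a : ℕ → ℝ} {L : ℝ} (ha : Tendsto (fun n ↦ s n ^ 2 * a n) atTop (𝓝 (L ^ 2 / 2)))
    (hL : 0 ≤ L) {g : ℕ → S → ℝ} {M : ℝ} (hgm : ∀ n, Measurable (g n))
    (hgM : ∀ n x, |g n x| ≤ M) {φ : T → ℝ}
    (hg : ∀ u, Tendsto (fun n ↦ g n (γ ((s n)⁻¹ • u))) atTop (𝓝 (φ u))) :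
    Tendsto (fun n : ℕ ↦ n * ∫ x in {x | D x ≤ a n}, g n x * μ.real {y | D x < D y} ^ (n - 1) ∂μ)
      atTop (𝓝 ((unitDepthVolume T)⁻¹ * ∫ u in Metric.closedBall 0 L,
        φ u * Real.exp (-(‖u‖ / √2) ^ Module.finrank ℝ T))) := by
  have hM : 0 ≤ M := (abs_nonneg _).trans (hgM 0 (γ 0))
  refine tendsto_nat_mul_of_scaled h0 hsn
    (H.tendsto_scaled_setIntegral_shrinking_cap hs ha hL hM (fun n ↦ ?_) (.of_forall fun n x ↦ ?_)
      fun u ↦ ?_)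
  · exact (hgm n).mul (H.measurable_measureReal_depth_gt.pow_const _)
  · rw [abs_mul, abs_of_nonneg (by positivity : 0 ≤ μ.real {y | D x < D y} ^ (n - 1))]
    exact (mul_le_of_le_one_right (abs_nonneg _)
      (pow_le_one₀ measureReal_nonneg measureReal_le_one)).trans (hgM n x)
  · exact (hg u).mul
      (H.tendsto_depth_gt_pow_sub_one h0 hs hsn (H.tendsto_sq_mul_depth hs u) (norm_nonneg u))

end Sequence

end IsGnomonicModel

/-- Up to a constant, a bound for the scaled effect on the attention output of a point `y` of the
context when `x` is closer to the query and has depth at most `a`. -/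
noncomputable def pairWeight {S : Type*} (D : S → ℝ) (β s a : ℝ) (x y : S) : ℝ :=
  if D x ≤ a ∧ D x ≤ D y then Real.exp (-(β * (D y - D x))) * (1 + s * √(D y)) else 0

section PairWeight

variable {S : Type*} {D : S → ℝ} {β s a : ℝ}

theorem pairWeight_nonneg (hs : 0 ≤ s) (x y : S) : 0 ≤ pairWeight D β s a x y := by
  unfold pairWeight
  positivity

theorem measurable_pairWeight [MeasurableSpace S] (hD : Measurable D) :
    Measurable (Function.uncurry (pairWeight D β s a)) := by
  have hset : MeasurableSet {p : S × S | D p.1 ≤ a ∧ D p.1 ≤ D p.2} :=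
    (measurableSet_le (hD.comp measurable_fst) measurable_const).inter
      (measurableSet_le (hD.comp measurable_fst) (hD.comp measurable_snd))
  exact .ite hset (by fun_prop) measurable_const

theorem one_add_sqrt_le_two_mul_exp_half {t : ℝ} (ht : 0 ≤ t) :
    1 + √t ≤ 2 * Real.exp (t / 2) := by
  have hsqrt : √t ≤ 1 + t := Real.sqrt_le_iff.2 ⟨by positivity, by nlinarith⟩
  linarith [Real.add_one_le_exp (t / 2)]

theorem pairWeight_le (hs : 0 ≤ s) (hβ : s ^ 2 ≤ β) {τ : ℝ} (ha : s ^ 2 * a ≤ τ)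
    (hD : ∀ x, 0 ≤ D x) (x y : S) :
    pairWeight D β s a x y ≤ 2 * Real.exp τ * Real.exp (-(s ^ 2 * D y / 2)) := by
  rw [pairWeight]
  split_ifs with hxy
  · have hx : s ^ 2 * D x ≤ τ := le_trans (by gcongr; exact hxy.1) ha
    have hsqrt : s * √(D y) = √(s ^ 2 * D y) := by
      rw [Real.sqrt_mul (sq_nonneg s), Real.sqrt_sq hs]
    have hexponent : -(β * (D y - D x)) ≤ τ + -(s ^ 2 * D y) := by
      have := mul_le_mul_of_nonneg_right hβ (sub_nonneg.2 hxy.2)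
      linarith
    calc Real.exp (-(β * (D y - D x))) * (1 + s * √(D y))
        ≤ Real.exp (τ + -(s ^ 2 * D y)) * (2 * Real.exp (s ^ 2 * D y / 2)) := by
          rw [hsqrt]
          gcongr
          exact one_add_sqrt_le_two_mul_exp_half (mul_nonneg (sq_nonneg s) (hD y))
      _ = 2 * Real.exp (τ + -(s ^ 2 * D y) + s ^ 2 * D y / 2) := by
          rw [Real.exp_add (τ + -(s ^ 2 * D y))]
          ring
      _ = 2 * Real.exp τ * Real.exp (-(s ^ 2 * D y / 2)) := by
          rw [mul_assoc, ← Real.exp_add]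
          ring_nf
  · positivity

end PairWeight

namespace IsGnomonicModel

variable {S T : Type*} [MeasurableSpace S] [NormedAddCommGroup T] [InnerProductSpace ℝ T]
  [FiniteDimensional ℝ T] [MeasurableSpace T] [BorelSpace T] {μ : Measure S} {D : S → ℝ}
  {γ : T → S} {h : T → ℝ} {s β a : ℕ → ℝ}

theorem tendsto_pairWeight_chart (H : IsGnomonicModel μ D γ h) (hs : Tendsto s atTop atTop)
    (hβ : Tendsto (fun n ↦ β n / s n ^ 2) atTop atTop) {u u' : T} (hu : ‖u'‖ ≠ ‖u‖) :
    Tendsto (fun n ↦ pairWeight D (β n) (s n) (a n) (γ ((s n)⁻¹ • u)) (γ ((s n)⁻¹ • u')))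
      atTop (𝓝 0) := by
  have hD := H.tendsto_sq_mul_depth hs u
  have hD' := H.tendsto_sq_mul_depth hs u'
  rcases hu.lt_or_gt with hlt | hgt
  · refine tendsto_const_nhds.congr' ?_
    filter_upwards [hD'.eventually_lt hD (by gcongr), hs.eventually_gt_atTop 0] with n hn hsn
    exact (if_neg fun hle ↦ (lt_of_mul_lt_mul_left hn (by positivity)).not_ge hle.2).symm
  · have hgap : 0 < ‖u'‖ ^ 2 / 2 - ‖u‖ ^ 2 / 2 := sub_pos.2 (by gcongr)
    have hexp := (Real.tendsto_exp_neg_atTop_nhds_zero.comp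
      (hβ.atTop_mul_pos hgap (hD'.sub hD))).mul (hD'.sqrt.const_add 1)
    rw [zero_mul] at hexp
    refine squeeze_zero' ?_ ?_ hexp
    · filter_upwards [hs.eventually_ge_atTop 0] with n hn
      exact pairWeight_nonneg hn _ _
    · filter_upwards [hs.eventually_gt_atTop 0] with n hn
      rw [pairWeight]
      split_ifs
      · rw [Function.comp_apply, Real.sqrt_mul (sq_nonneg _), Real.sqrt_sq hn.le, ← mul_sub,
          ← mul_assoc (β n / _), div_mul_cancel₀ _ (by positivity)]
      · exact mul_nonneg (Real.exp_pos _).le (by positivity)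

theorem exists_scaled_integral_pairWeight_le [IsFiniteMeasure μ] (H : IsGnomonicModel μ D γ h)
    (hs : Tendsto s atTop atTop) (hβ : Tendsto (fun n ↦ β n / s n ^ 2) atTop atTop) {τ : ℝ}
    (ha : ∀ᶠ n in atTop, s n ^ 2 * a n ≤ τ) :
    ∃ Q, 0 ≤ Q ∧ ∀ᶠ n in atTop, ∀ x,
      |s n ^ Module.finrank ℝ T * ∫ y, pairWeight D (β n) (s n) (a n) x y ∂μ| ≤ Q := by
  have hmeas (n : ℕ) : Measurable fun y ↦ Real.exp (-(s n ^ 2 * D y / 2)) :=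
    ((H.measurable_depth.const_mul _).div_const 2).neg.exp
  have hint (n : ℕ) : Integrable (fun y ↦ Real.exp (-(s n ^ 2 * D y / 2))) μ := by
    refine .of_bound (hmeas n).aestronglyMeasurable 1 (ae_of_all _ fun y ↦ ?_)
    have := H.depth_nonneg y
    rw [Real.norm_of_nonneg (Real.exp_pos _).le, Real.exp_le_one_iff, neg_nonpos]
    positivity
  have hlim := (H.tendsto_scaled_integral hs zero_le_one (.of_forall hmeas)
    (.of_forall fun n x ↦ by rw [one_mul, abs_of_pos (Real.exp_pos _)])
    (ae_of_all _ fun u ↦ ((H.tendsto_sq_mul_depth hs u).div_const 2).neg.rexp)).const_mul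
      (2 * Real.exp τ)
  set Q := 2 * Real.exp τ * (h 0 * ∫ u : T, Real.exp (-(‖u‖ ^ 2 / 2 / 2)))
  refine ⟨|Q| + 1, by positivity, ?_⟩
  filter_upwards [ha, hs.eventually_gt_atTop 0, hβ.eventually_ge_atTop 1,
    hlim.eventually_le_const ((le_abs_self Q).trans_lt (lt_add_one _))] with n hn hsn hβn hQn x
  refine le_trans ?_ hQn
  have hpair (y : S) : ‖pairWeight D (β n) (s n) (a n) x y‖ ≤
      2 * Real.exp τ * Real.exp (-(s n ^ 2 * D y / 2)) := by
    rw [Real.norm_of_nonneg (pairWeight_nonneg hsn.le x y)]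
    exact pairWeight_le hsn.le ((one_le_div (by positivity)).1 hβn) hn H.depth_nonneg x y
  rw [abs_mul, abs_of_pos (by positivity), mul_left_comm, ← integral_const_mul]
  gcongr
  exact norm_integral_le_of_norm_le ((hint n).const_mul _) (ae_of_all _ hpair)

theorem tendsto_scaled_integral_pairWeight_chart [IsFiniteMeasure μ] [Nontrivial T]
    (H : IsGnomonicModel μ D γ h) (hs : Tendsto s atTop atTop)
    (hβ : Tendsto (fun n ↦ β n / s n ^ 2) atTop atTop) {τ : ℝ}
    (ha : ∀ᶠ n in atTop, s n ^ 2 * a n ≤ τ) (u : T) :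
    Tendsto (fun n ↦ s n ^ Module.finrank ℝ T *
      ∫ y, pairWeight D (β n) (s n) (a n) (γ ((s n)⁻¹ • u)) y ∂μ) atTop (𝓝 0) := by
  have hlim := H.tendsto_scaled_integral hs (c := 2 * Real.exp τ) (by positivity)
    (Φ := fun n y ↦ pairWeight D (β n) (s n) (a n) (γ ((s n)⁻¹ • u)) y) (φ := fun _ ↦ 0)
    (.of_forall fun n ↦ (measurable_pairWeight H.measurable_depth).of_uncurry_left) ?_ ?_
  · simpa using hlim
  · filter_upwards [ha, hs.eventually_gt_atTop 0, hβ.eventually_ge_atTop 1] with n hn hsn hβn y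
    rw [abs_of_nonneg (pairWeight_nonneg hsn.le _ y)]
    exact pairWeight_le hsn.le ((one_le_div (by positivity)).1 hβn) hn H.depth_nonneg _ y
  · filter_upwards [measure_eq_zero_iff_ae_notMem.1 (Measure.addHaar_sphere volume (0 : T) ‖u‖)]
      with u' hu'
    exact H.tendsto_pairWeight_chart hs hβ (by simpa using hu')

theorem tendsto_pair_term [IsFiniteMeasure μ] [Nontrivial T] (H : IsGnomonicModel μ D γ h)
    (h0 : 0 < h 0) (hs : Tendsto s atTop atTop)
    (hsn : ∀ n : ℕ, s n ^ Module.finrank ℝ T = intensity h * n)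
    (hβ : Tendsto (fun n ↦ β n / s n ^ 2) atTop atTop) {L : ℝ}
    (ha : Tendsto (fun n ↦ s n ^ 2 * a n) atTop (𝓝 (L ^ 2 / 2))) (hL : 0 ≤ L) :
    Tendsto (fun n : ℕ ↦ (n : ℝ) ^ 2 * ∫ x, ∫ y, pairWeight D (β n) (s n) (a n) x y ∂μ ∂μ)
      atTop (𝓝 0) := by
  have hτ := ha.eventually_le_const (lt_add_one _)
  obtain ⟨Q, hQ, hbound⟩ := H.exists_scaled_integral_pairWeight_le hs hβ hτ
  have hcap (n : ℕ) : ∫ x, ∫ y, pairWeight D (β n) (s n) (a n) x y ∂μ ∂μ =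
      ∫ x in {x | D x ≤ a n}, ∫ y, pairWeight D (β n) (s n) (a n) x y ∂μ ∂μ := by
    refine (setIntegral_eq_integral_of_forall_compl_eq_zero fun x hx ↦ ?_).symm
    simp [pairWeight, show ¬D x ≤ a n from hx]
  have hlim := tendsto_nat_mul_of_scaled h0 hsn (H.tendsto_scaled_setIntegral_shrinking_cap hs ha
    hL (g := fun n x ↦ s n ^ Module.finrank ℝ T * ∫ y, pairWeight D (β n) (s n) (a n) x y ∂μ) hQ
    (fun n ↦ ((measurable_pairWeight H.measurable_depth).stronglyMeasurable.integral_prod_right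
      ).measurable.const_mul _) hbound
    (H.tendsto_scaled_integral_pairWeight_chart hs hβ hτ))
  have hscaled := hlim.const_mul (intensity h)⁻¹
  simp only [integral_zero, mul_zero] at hscaled
  refine hscaled.congr fun n ↦ ?_
  rw [hcap, integral_const_mul, hsn]
  have := (intensity_pos h0).ne'
  field_simp

end IsGnomonicModel

/-- The configurations in which the `i`-th point is the strict minimiser of `D`, of value at most
`a`. -/
def nearestSet {S : Type*} (D : S → ℝ) (a : ℝ) {n : ℕ} (i : Fin n) : Set (Fin n → S) :=
  {x | D (x i) ≤ a ∧ ∀ j ≠ i, D (x i) < D (x j)}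

/-- The attention output before applying `V`, relative to the query. -/
noncomputable def attentionShift {d n : ℕ} (β : ℝ) (q : UnitSphere d) (x : Fin n → UnitSphere d) :
    EuclideanSpace ℝ (Fin d) :=
  ∑ j, attentionWeight β q x j • (x j : EuclideanSpace ℝ (Fin d)) - q

section Attention

variable {d n : ℕ} {β : ℝ} {q : UnitSphere d} {x : Fin n → UnitSphere d}

theorem attentionDisplacement_eq (V : Matrix (Fin d) (Fin d) ℝ) :
    attentionDisplacement V β q x = Matrix.toEuclideanCLM (𝕜 := ℝ) V (attentionShift β q x) :=
  (map_sub _ _ _).symm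

theorem measurable_attentionShift (n : ℕ) (β : ℝ) (q : UnitSphere d) :
    Measurable (attentionShift (n := n) β q) := by
  unfold attentionShift attentionWeight
  fun_prop

theorem norm_sub_query (q x : UnitSphere d) :
    ‖(x : EuclideanSpace ℝ (Fin d)) - q‖ = √2 * √(queryDepth q x) := by
  rw [← Real.sqrt_mul zero_le_two, ← Real.sqrt_sq (norm_nonneg _), norm_sub_sq_real,
    norm_eq_of_mem_sphere, norm_eq_of_mem_sphere, real_inner_comm, queryDepth]
  ring_nf

theorem attentionWeight_nonneg (j : Fin n) : 0 ≤ attentionWeight β q x j := by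
  unfold attentionWeight
  positivity

theorem sum_attentionWeight [NeZero n] : ∑ j, attentionWeight β q x j = 1 := by
  unfold attentionWeight
  rw [← Finset.sum_div, div_self]
  exact (Finset.sum_pos (fun _ _ ↦ Real.exp_pos _) Finset.univ_nonempty).ne'

theorem attentionWeight_le (i j : Fin n) :
    attentionWeight β q x j ≤ Real.exp (-(β * (queryDepth q (x j) - queryDepth q (x i)))) := by
  have hexponent : -(β * (queryDepth q (x j) - queryDepth q (x i))) =
      β * inner ℝ q.1 (x j).1 - β * inner ℝ q.1 (x i).1 := by
    unfold queryDepth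
    ring
  rw [hexponent, Real.exp_sub, attentionWeight]
  gcongr
  exact Finset.single_le_sum (f := fun l ↦ Real.exp (β * inner ℝ q.1 (x l).1))
    (fun _ _ ↦ (Real.exp_pos _).le) (Finset.mem_univ i)

theorem norm_sub_le_of_queryDepth_le {y z : UnitSphere d}
    (h : queryDepth q y ≤ queryDepth q z) :
    ‖(z : EuclideanSpace ℝ (Fin d)) - y‖ ≤ 3 * √(queryDepth q z) := by
  have hsqrt : √2 ≤ 3 / 2 := Real.sqrt_le_iff.2 ⟨by norm_num, by norm_num⟩
  calc ‖(z : EuclideanSpace ℝ (Fin d)) - y‖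
      = ‖((z : EuclideanSpace ℝ (Fin d)) - q) - (y - q)‖ := by rw [sub_sub_sub_cancel_right]
    _ ≤ √2 * √(queryDepth q z) + √2 * √(queryDepth q y) := by
        rw [← norm_sub_query, ← norm_sub_query]
        exact norm_sub_le _ _
    _ ≤ 3 / 2 * √(queryDepth q z) + 3 / 2 * √(queryDepth q z) := by gcongr
    _ = 3 * √(queryDepth q z) := by ring

theorem norm_attentionShift_sub_le {i : Fin n}
    (hi : ∀ j, queryDepth q (x i) ≤ queryDepth q (x j)) :
    ‖attentionShift β q x - ((x i : EuclideanSpace ℝ (Fin d)) - q)‖ ≤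
      ∑ j ∈ Finset.univ.erase i, Real.exp (-(β * (queryDepth q (x j) - queryDepth q (x i)))) *
        (3 * √(queryDepth q (x j))) := by
  have : NeZero n := ⟨(Fin.pos i).ne'⟩
  have hsum : attentionShift β q x - ((x i : EuclideanSpace ℝ (Fin d)) - q) =
      ∑ j ∈ Finset.univ.erase i,
        attentionWeight β q x j • ((x j : EuclideanSpace ℝ (Fin d)) - x i) := by
    rw [attentionShift, sub_sub_sub_cancel_right, Finset.sum_erase _ (by simp)]
    simp_rw [smul_sub]
    rw [Finset.sum_sub_distrib, ← Finset.sum_smul, sum_attentionWeight, one_smul]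
  rw [hsum]
  refine (norm_sum_le _ _).trans (Finset.sum_le_sum fun j _ ↦ ?_)
  rw [norm_smul, Real.norm_of_nonneg (attentionWeight_nonneg j)]
  exact mul_le_mul (attentionWeight_le i j) (norm_sub_le_of_queryDepth_le (hi j))
    (norm_nonneg _) (Real.exp_pos _).le

variable {f : EuclideanSpace ℝ (Fin d) → ℝ} {M s a : ℝ} {K : NNReal}

theorem abs_sub_le_sum_pairWeight (hK : LipschitzWith K f) (hs : 0 ≤ s) {i : Fin n}
    (hi : ∀ j, queryDepth q (x i) ≤ queryDepth q (x j)) (hia : queryDepth q (x i) ≤ a) :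
    |f (s • attentionShift β q x) - f (s • ((x i : EuclideanSpace ℝ (Fin d)) - q))| ≤
      3 * K * ∑ j ∈ Finset.univ.erase i, pairWeight (queryDepth q) β s a (x i) (x j) := by
  have hLip := hK.dist_le_mul (s • attentionShift β q x)
    (s • ((x i : EuclideanSpace ℝ (Fin d)) - q))
  rw [Real.dist_eq, dist_eq_norm, ← smul_sub, norm_smul, Real.norm_of_nonneg hs] at hLip
  calc |f (s • attentionShift β q x) - f (s • ((x i : EuclideanSpace ℝ (Fin d)) - q))|
      ≤ K * (s * ∑ j ∈ Finset.univ.erase i,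
          Real.exp (-(β * (queryDepth q (x j) - queryDepth q (x i)))) *
            (3 * √(queryDepth q (x j)))) :=
        hLip.trans (by gcongr; exact norm_attentionShift_sub_le hi)
    _ = 3 * K * ∑ j ∈ Finset.univ.erase i,
          Real.exp (-(β * (queryDepth q (x j) - queryDepth q (x i)))) *
            (s * √(queryDepth q (x j))) := by
        simp_rw [Finset.mul_sum]
        exact Finset.sum_congr rfl fun j _ ↦ by ring
    _ ≤ 3 * K * ∑ j ∈ Finset.univ.erase i, pairWeight (queryDepth q) β s a (x i) (x j) := by
        gcongr with j
        rw [pairWeight, if_pos ⟨hia, hi j⟩]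
        gcongr
        linarith

theorem one_le_sum_pairWeight_of_tie (hs : 0 ≤ s) {i j : Fin n} (hji : j ≠ i)
    (hj : queryDepth q (x j) = queryDepth q (x i)) (hia : queryDepth q (x i) ≤ a) :
    1 ≤ ∑ j ∈ Finset.univ.erase i, pairWeight (queryDepth q) β s a (x i) (x j) := by
  refine le_trans ?_ (Finset.single_le_sum (fun j _ ↦ pairWeight_nonneg hs (x i) (x j))
    (Finset.mem_erase.2 ⟨hji, Finset.mem_univ j⟩))
  rw [pairWeight, if_pos ⟨hia, hj.ge⟩, hj, sub_self, mul_zero, neg_zero, Real.exp_zero, one_mul]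
  exact le_add_of_nonneg_right (by positivity)

theorem abs_sub_indicator_nearest_le (hM : ∀ z, |f z| ≤ M) (hK : LipschitzWith K f) (hs : 0 ≤ s)
    {i : Fin n} (hi : ∀ j, queryDepth q (x i) ≤ queryDepth q (x j))
    (hia : queryDepth q (x i) ≤ a) :
    |f (s • attentionShift β q x) - (nearestSet (queryDepth q) a i).indicator
        (fun x ↦ f (s • ((x i : EuclideanSpace ℝ (Fin d)) - q))) x| ≤
      (M + 3 * K) * ∑ j ∈ Finset.univ.erase i, pairWeight (queryDepth q) β s a (x i) (x j) := by
  have hM0 : 0 ≤ M := (abs_nonneg _).trans (hM 0)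
  have hpair : 0 ≤ ∑ j ∈ Finset.univ.erase i, pairWeight (queryDepth q) β s a (x i) (x j) :=
    Finset.sum_nonneg fun j _ ↦ pairWeight_nonneg hs _ _
  rw [add_mul]
  by_cases hstrict : ∀ j ≠ i, queryDepth q (x i) < queryDepth q (x j)
  · rw [Set.indicator_of_mem (show x ∈ nearestSet (queryDepth q) a i from ⟨hia, hstrict⟩)]
    exact (abs_sub_le_sum_pairWeight hK hs hi hia).trans
      (le_add_of_nonneg_left (mul_nonneg hM0 hpair))
  · rw [Set.indicator_of_notMem fun h ↦ hstrict h.2, sub_zero]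
    push Not at hstrict
    obtain ⟨j, hji, hj⟩ := hstrict
    have htie := one_le_sum_pairWeight_of_tie (β := β) hs hji (hj.antisymm (hi j)) hia
    exact (hM _).trans ((le_mul_of_one_le_right hM0 htie).trans
      (le_add_of_nonneg_right (by positivity)))

theorem abs_sub_sum_nearest_le [NeZero n] (hM : ∀ z, |f z| ≤ M) (hK : LipschitzWith K f)
    (hs : 0 ≤ s) (a : ℝ) :
    |f (s • attentionShift β q x) - ∑ i, (nearestSet (queryDepth q) a i).indicator
        (fun x ↦ f (s • ((x i : EuclideanSpace ℝ (Fin d)) - q))) x| ≤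
      {x : Fin n → UnitSphere d | ∀ i, a < queryDepth q (x i)}.indicator (fun _ ↦ M) x +
      (M + 3 * K) * ∑ i, ∑ j ∈ Finset.univ.erase i,
        pairWeight (queryDepth q) β s a (x i) (x j) := by
  have hM0 : 0 ≤ M := (abs_nonneg _).trans (hM 0)
  have hpair (i : Fin n) :
      0 ≤ ∑ j ∈ Finset.univ.erase i, pairWeight (queryDepth q) β s a (x i) (x j) :=
    Finset.sum_nonneg fun j _ ↦ pairWeight_nonneg hs _ _
  by_cases hfar : ∀ i, a < queryDepth q (x i)
  · have hnone (i : Fin n) : x ∉ nearestSet (queryDepth q) a i := fun h ↦ h.1.not_gt (hfar i)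
    simp_rw [Set.indicator_of_notMem (hnone _), Finset.sum_const_zero, sub_zero]
    rw [Set.indicator_of_mem (by exact hfar)]
    exact (hM _).trans (le_add_of_nonneg_right
      (mul_nonneg (by positivity) (Finset.sum_nonneg fun i _ ↦ hpair i)))
  · obtain ⟨i, hi⟩ := Finite.exists_min fun i ↦ queryDepth q (x i)
    push Not at hfar
    obtain ⟨k, hk⟩ := hfar
    have hother (l : Fin n) (hl : l ≠ i) : x ∉ nearestSet (queryDepth q) a l :=
      fun h ↦ (h.2 i hl.symm).not_ge (hi l)
    rw [Set.indicator_of_notMem fun h ↦ (h k).not_ge hk, zero_add,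
      Finset.sum_eq_single_of_mem i (Finset.mem_univ i)
        fun l _ hl ↦ Set.indicator_of_notMem (hother l hl) _]
    refine (abs_sub_indicator_nearest_le hM hK hs hi ((hi k).trans hk)).trans ?_
    gcongr
    exact Finset.single_le_sum (fun i _ ↦ hpair i) (Finset.mem_univ i)

end Attention

theorem mem_nearestSet_insertNth {S : Type*} {D : S → ℝ} {a : ℝ} {n : ℕ} {i : Fin (n + 1)}
    {y : S} {z : Fin n → S} :
    i.insertNth (α := fun _ ↦ S) y z ∈ nearestSet D a i ↔ D y ≤ a ∧ ∀ j, D y < D (z j) := by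
  simp [nearestSet, Fin.forall_iff_succAbove i]

section Pi

variable {S : Type*} [MeasurableSpace S] {D : S → ℝ}

theorem measurableSet_forall_lt (hD : Measurable D) {n : ℕ} (a : ℝ) :
    MeasurableSet {x : Fin n → S | ∀ i, a < D (x i)} := by
  measurability

theorem measurableSet_nearestSet (hD : Measurable D) (a : ℝ) {n : ℕ} (i : Fin n) :
    MeasurableSet (nearestSet D a i) := by
  unfold nearestSet
  measurability

variable {μ : Measure S} [IsProbabilityMeasure μ]

theorem pi_real_forall_lt (n : ℕ) (a : ℝ) :
    (Measure.pi fun _ : Fin n ↦ μ).real {x | ∀ i, a < D (x i)} = μ.real {y | a < D y} ^ n := by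
  have hpi : {x : Fin n → S | ∀ i, a < D (x i)} = Set.univ.pi fun _ ↦ {y | a < D y} := by
    ext
    simp
  simp [hpi, measureReal_def, Measure.pi_pi]

theorem integrable_indicator_nearest (hD : Measurable D) {g : S → ℝ} (hg : Measurable g) {M : ℝ}
    (hM : ∀ x, |g x| ≤ M) (a : ℝ) {n : ℕ} (i : Fin n) :
    Integrable ((nearestSet D a i).indicator fun x ↦ g (x i)) (Measure.pi fun _ ↦ μ) :=
  (Integrable.of_bound (hg.comp (measurable_pi_apply i)).aestronglyMeasurable M
    (ae_of_all _ fun _ ↦ hM _)).indicator (measurableSet_nearestSet hD a i)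

theorem integral_pi_nearest (hD : Measurable D) {g : S → ℝ} (hg : Measurable g) {M : ℝ}
    (hM : ∀ x, |g x| ≤ M) {n : ℕ} (a : ℝ) (i : Fin n) :
    ∫ x, (nearestSet D a i).indicator (fun x ↦ g (x i)) x ∂(Measure.pi fun _ ↦ μ) =
      ∫ x in {x | D x ≤ a}, g x * μ.real {y | D x < D y} ^ (n - 1) ∂μ := by
  obtain ⟨k, rfl⟩ := Nat.exists_eq_add_one_of_ne_zero (Fin.pos i).ne'
  have hmp := (measurePreserving_piFinSuccAbove (fun _ ↦ μ) i).symm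
  have hslice (y : S) (z : Fin k → S) :
      (nearestSet D a i).indicator (fun x ↦ g (x i))
        ((MeasurableEquiv.piFinSuccAbove (fun _ ↦ S) i).symm (y, z)) =
      {y | D y ≤ a}.indicator
        (fun y ↦ {z : Fin k → S | ∀ j, D y < D (z j)}.indicator (fun _ ↦ g y) z) y := by
    classical
    change (nearestSet D a i).indicator (fun x ↦ g (x i)) (i.insertNth y z) = _
    simp only [Set.indicator_apply, mem_nearestSet_insertNth, Fin.insertNth_apply_same, ite_and]
    rfl
  rw [← hmp.integral_comp', integral_prod (fun p ↦ (nearestSet D a i).indicator (fun x ↦ g (x i))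
      ((MeasurableEquiv.piFinSuccAbove (fun _ ↦ S) i).symm p))
    (hmp.integrable_comp_of_integrable (integrable_indicator_nearest hD hg hM a i)),
    ← integral_indicator (measurableSet_le hD measurable_const)]
  congr with y
  simp_rw [hslice]
  by_cases hy : D y ≤ a
  · simp_rw [Set.indicator_of_mem (show y ∈ {y | D y ≤ a} from hy)]
    rw [integral_indicator_const _ (measurableSet_forall_lt hD _), pi_real_forall_lt, smul_eq_mul,
      mul_comm, Nat.add_sub_cancel]
  · simp_rw [Set.indicator_of_notMem (show y ∉ {y | D y ≤ a} from hy), integral_zero]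

theorem integral_pi_sum_nearest (hD : Measurable D) {g : S → ℝ} (hg : Measurable g) {M : ℝ}
    (hM : ∀ x, |g x| ≤ M) (n : ℕ) (a : ℝ) :
    ∫ x, ∑ i : Fin n, (nearestSet D a i).indicator (fun x ↦ g (x i)) x
        ∂(Measure.pi fun _ ↦ μ) =
      n * ∫ x in {x | D x ≤ a}, g x * μ.real {y | D x < D y} ^ (n - 1) ∂μ := by
  rw [integral_finsetSum _ fun i _ ↦ integrable_indicator_nearest hD hg hM a i]
  simp [integral_pi_nearest hD hg hM a]

theorem measurePreserving_eval_pair {n : ℕ} {i j : Fin n} (hij : i ≠ j) :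
    MeasurePreserving (fun x : Fin n → S ↦ (x i, x j)) (Measure.pi fun _ ↦ μ) (μ.prod μ) := by
  refine ⟨by fun_prop, ?_⟩
  have hind := iIndepFun_pi (μ := fun _ : Fin n ↦ μ) (X := fun _ ↦ id) fun _ ↦ aemeasurable_id
  refine ((indepFun_iff_map_prod_eq_prod_map_map (measurable_pi_apply i).aemeasurable
    (measurable_pi_apply j).aemeasurable).1 (hind.indepFun hij)).trans ?_
  congr 1 <;> exact (measurePreserving_eval (fun _ : Fin n ↦ μ) _).map_eq

theorem integrable_pi_sum_pairs {k : S → S → ℝ} (hk : Integrable (Function.uncurry k) (μ.prod μ))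
    (n : ℕ) :
    Integrable (fun x : Fin n → S ↦ ∑ i, ∑ j ∈ Finset.univ.erase i, k (x i) (x j))
      (Measure.pi fun _ ↦ μ) :=
  integrable_finsetSum _ fun _ _ ↦ integrable_finsetSum _ fun _ hj ↦
    (measurePreserving_eval_pair (Finset.ne_of_mem_erase hj).symm).integrable_comp_of_integrable hk

theorem integral_pi_sum_pairs_le {k : S → S → ℝ}
    (hk : Integrable (Function.uncurry k) (μ.prod μ)) (hk0 : ∀ x y, 0 ≤ k x y) (n : ℕ) :
    ∫ x : Fin n → S, ∑ i, ∑ j ∈ Finset.univ.erase i, k (x i) (x j) ∂(Measure.pi fun _ ↦ μ) ≤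
      (n : ℝ) ^ 2 * ∫ x, ∫ y, k x y ∂μ ∂μ := by
  have hpair (i : Fin n) (j) (hj : j ∈ Finset.univ.erase i) :
      Integrable (fun x : Fin n → S ↦ k (x i) (x j)) (Measure.pi fun _ ↦ μ) ∧
      ∫ x : Fin n → S, k (x i) (x j) ∂(Measure.pi fun _ ↦ μ) = ∫ x, ∫ y, k x y ∂μ ∂μ := by
    have hmp := measurePreserving_eval_pair (μ := μ) (Finset.ne_of_mem_erase hj).symm
    refine ⟨hmp.integrable_comp_of_integrable hk, ?_⟩
    rw [integral_integral hk, ← hmp.map_eq]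
    exact (integral_map hmp.aemeasurable (by rw [hmp.map_eq]; exact hk.1)).symm
  have hnonneg : 0 ≤ ∫ x, ∫ y, k x y ∂μ ∂μ :=
    integral_nonneg fun x ↦ integral_nonneg fun y ↦ hk0 x y
  rw [integral_finsetSum _ fun i _ ↦ integrable_finsetSum _ fun j hj ↦ (hpair i j hj).1]
  calc ∑ i, ∫ x : Fin n → S, ∑ j ∈ Finset.univ.erase i, k (x i) (x j) ∂(Measure.pi fun _ ↦ μ)
      ≤ ∑ _ : Fin n, n * ∫ x, ∫ y, k x y ∂μ ∂μ := by
        gcongr with i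
        rw [integral_finsetSum _ fun j hj ↦ (hpair i j hj).1,
          Finset.sum_congr rfl fun j hj ↦ (hpair i j hj).2, Finset.sum_const, nsmul_eq_mul]
        gcongr
        exact (Finset.card_le_univ _).trans (by simp)
    _ = (n : ℝ) ^ 2 * ∫ x, ∫ y, k x y ∂μ ∂μ := by
        simp
        ring

theorem integrable_pairWeight (hD : Measurable D) (hD0 : ∀ x, 0 ≤ D x) {β s : ℝ} (hs : 0 ≤ s)
    (hβ : s ^ 2 ≤ β) (a : ℝ) :
    Integrable (Function.uncurry (pairWeight D β s a)) (μ.prod μ) := by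
  refine .of_bound (measurable_pairWeight hD).aestronglyMeasurable (2 * Real.exp (s ^ 2 * a))
    (ae_of_all _ fun p ↦ ?_)
  rw [Function.uncurry_def, Real.norm_of_nonneg (pairWeight_nonneg hs _ _)]
  refine (pairWeight_le hs hβ le_rfl hD0 p.1 p.2).trans
    (mul_le_of_le_one_right (by positivity) (Real.exp_le_one_iff.2 ?_))
  have := hD0 p.2
  rw [neg_nonpos]
  positivity

end Pi

theorem abs_integral_attentionShift_sub_nearest_le {d : ℕ} {q : UnitSphere d}
    {μ : Measure (UnitSphere d)} [IsProbabilityMeasure μ] {f : EuclideanSpace ℝ (Fin d) → ℝ} {M : ℝ}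
    (hM : ∀ z, |f z| ≤ M) {K : NNReal} (hK : LipschitzWith K f) {n : ℕ} [NeZero n] {s β : ℝ}
    (hs : 0 ≤ s) (hβ : s ^ 2 ≤ β) (a : ℝ) :
    |∫ x : Fin n → UnitSphere d, f (s • attentionShift β q x) ∂(Measure.pi fun _ ↦ μ) -
      n * ∫ x in {x | queryDepth q x ≤ a}, f (s • ((x : EuclideanSpace ℝ (Fin d)) - q)) *
        μ.real {y | queryDepth q x < queryDepth q y} ^ (n - 1) ∂μ| ≤
      M * μ.real {x | a < queryDepth q x} ^ n +
      (M + 3 * K) * ((n : ℝ) ^ 2 * ∫ x, ∫ y, pairWeight (queryDepth q) β s a x y ∂μ ∂μ) := by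
  have hM0 : 0 ≤ M := (abs_nonneg _).trans (hM 0)
  have hD := (continuous_queryDepth q).measurable
  have hf := hK.continuous.measurable
  have hg : Measurable fun x : UnitSphere d ↦ f (s • ((x : EuclideanSpace ℝ (Fin d)) - q)) :=
    hf.comp (by fun_prop)
  have hfar := measurableSet_forall_lt (n := n) hD a
  have hpairs := integrable_pairWeight (μ := μ) hD (queryDepth_nonneg q) hs hβ a
  have hF : Integrable (fun x : Fin n → UnitSphere d ↦ f (s • attentionShift β q x))
      (Measure.pi fun _ ↦ μ) :=
    .of_bound (hf.comp ((measurable_attentionShift n β q).const_smul s)).aestronglyMeasurable M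
      (ae_of_all _ fun _ ↦ hM _)
  have hN : Integrable (fun x ↦ ∑ i : Fin n, (nearestSet (queryDepth q) a i).indicator
      (fun x ↦ f (s • ((x i : EuclideanSpace ℝ (Fin d)) - q))) x) (Measure.pi fun _ ↦ μ) :=
    integrable_finsetSum _ fun i _ ↦ integrable_indicator_nearest hD hg (fun _ ↦ hM _) a i
  have hempty := (integrable_const (μ := Measure.pi fun _ : Fin n ↦ μ) M).indicator hfar
  have hsum := (integrable_pi_sum_pairs hpairs n).const_mul (M + 3 * K)
  rw [← integral_pi_sum_nearest hD hg (fun _ ↦ hM _) n a, ← integral_sub hF hN]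
  refine (abs_integral_le_integral_abs.trans (integral_mono (hF.sub hN).abs (hempty.add hsum)
    fun x ↦ abs_sub_sum_nearest_le hM hK hs a)).trans ?_
  simp only [Pi.add_apply]
  rw [integral_add hempty hsum, integral_indicator_const _ hfar,
    pi_real_forall_lt, smul_eq_mul, mul_comm, integral_const_mul]
  gcongr
  exact integral_pi_sum_pairs_le hpairs (pairWeight_nonneg hs) n

/-- The law on `(0, ∞)` of the distance to the origin under `nearestPointLaw`, in dimension `m`;
its tail is `exp (-(a / √2) ^ m)`. -/
noncomputable def radialLaw (m : ℕ) : Measure ℝ :=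
  (volume.restrict (Set.Ioi 0)).withDensity fun r ↦
    ENNReal.ofReal (m / √2 ^ m * r ^ (m - 1) * Real.exp (-(r / √2) ^ m))

theorem hasDerivAt_neg_exp_neg_div_sqrt_two_pow {m : ℕ} (hm : m ≠ 0) (r : ℝ) :
    HasDerivAt (fun r : ℝ ↦ -Real.exp (-(r / √2) ^ m))
      (m / √2 ^ m * r ^ (m - 1) * Real.exp (-(r / √2) ^ m)) r := by
  refine ((((hasDerivAt_id' r).div_const √2).pow m).neg).exp.neg.congr_deriv ?_
  obtain ⟨k, rfl⟩ := Nat.exists_eq_add_one_of_ne_zero hm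
  simp only [Pi.neg_apply, Pi.pow_apply, Nat.add_sub_cancel, div_pow]
  rw [pow_succ √2 k]
  field_simp

theorem tendsto_exp_neg_div_sqrt_two_pow {m : ℕ} (hm : m ≠ 0) :
    Tendsto (fun r : ℝ ↦ Real.exp (-(r / √2) ^ m)) atTop (𝓝 0) :=
  Real.tendsto_exp_neg_atTop_nhds_zero.comp
    ((tendsto_pow_atTop hm).comp (tendsto_id.atTop_div_const (by positivity)))

theorem radialLaw_Ioi {m : ℕ} (hm : m ≠ 0) {a : ℝ} (ha : 0 ≤ a) :
    radialLaw m (Set.Ioi a) = ENNReal.ofReal (Real.exp (-(a / √2) ^ m)) := by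
  have hderiv (r : ℝ) (_ : r ∈ Set.Ici a) := hasDerivAt_neg_exp_neg_div_sqrt_two_pow hm r
  have hnonneg : ∀ r ∈ Set.Ioi a, 0 ≤ m / √2 ^ m * r ^ (m - 1) * Real.exp (-(r / √2) ^ m) := by
    intro r hr
    have : 0 ≤ r := ha.trans hr.le
    positivity
  have hlim := (tendsto_exp_neg_div_sqrt_two_pow hm).neg
  rw [radialLaw, withDensity_apply _ measurableSet_Ioi, Measure.restrict_restrict measurableSet_Ioi,
    Set.inter_eq_left.2 (Set.Ioi_subset_Ioi ha), ← ofReal_integral_eq_lintegral_ofReal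
      (integrableOn_Ioi_deriv_of_nonneg' hderiv hnonneg hlim)
      ((ae_restrict_iff' measurableSet_Ioi).2 (ae_of_all _ hnonneg)),
    integral_Ioi_of_hasDerivAt_of_nonneg' hderiv hnonneg hlim, neg_zero, zero_sub, neg_neg]

theorem radialLaw_Ioi_of_nonpos {m : ℕ} (hm : m ≠ 0) {a : ℝ} (ha : a ≤ 0) :
    radialLaw m (Set.Ioi a) = 1 := by
  calc radialLaw m (Set.Ioi a) = radialLaw m (Set.Ioi 0) := by
        rw [radialLaw, withDensity_apply _ measurableSet_Ioi,
          withDensity_apply _ measurableSet_Ioi, Measure.restrict_restrict measurableSet_Ioi,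
          Measure.restrict_restrict measurableSet_Ioi, Set.inter_self,
          Set.inter_eq_right.2 (Set.Ioi_subset_Ioi ha)]
    _ = 1 := by simp [radialLaw_Ioi hm le_rfl, hm]

theorem isProbabilityMeasure_radialLaw {m : ℕ} (hm : m ≠ 0) :
    IsProbabilityMeasure (radialLaw m) := by
  refine ⟨?_⟩
  rw [← radialLaw_Ioi_of_nonpos hm le_rfl, radialLaw, withDensity_apply _ .univ,
    withDensity_apply _ measurableSet_Ioi, Measure.restrict_univ,
    Measure.restrict_restrict measurableSet_Ioi, Set.inter_self]

theorem IsWeibull.map_sqrt_two_mul {m : ℕ} (hm : m ≠ 0) {Ω : Type*} [MeasurableSpace Ω]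
    {P : Measure Ω} [IsProbabilityMeasure P] {R : Ω → ℝ} (hR : IsWeibull P (2 / m) R) :
    P.map (fun ω ↦ √(2 * R ω)) = radialLaw m := by
  have hmeas : Measurable fun ω ↦ √(2 * R ω) := (hR.measurable.const_mul 2).sqrt
  have := isProbabilityMeasure_radialLaw hm
  have := Measure.isProbabilityMeasure_map (μ := P) hmeas.aemeasurable
  refine Measure.ext_of_Iic _ _ fun a ↦ ?_
  rw [← Set.compl_Ioi, prob_compl_eq_one_sub measurableSet_Ioi,
    prob_compl_eq_one_sub measurableSet_Ioi, Measure.map_apply hmeas measurableSet_Ioi]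
  congr 1
  obtain ha | ha := lt_or_ge a 0
  · have hall : (fun ω ↦ √(2 * R ω)) ⁻¹' Set.Ioi a = Set.univ :=
      Set.eq_univ_of_forall fun ω ↦ ha.trans_le (Real.sqrt_nonneg (2 * R ω))
    rw [radialLaw_Ioi_of_nonpos hm ha.le, hall, measure_univ]
  · have htail : (fun ω ↦ √(2 * R ω)) ⁻¹' Set.Ioi a = {ω | (a / √2) ^ 2 < R ω} := by
      ext ω
      rw [Set.mem_preimage, Set.mem_Ioi, Real.lt_sqrt ha, Set.mem_ofPred_eq, div_pow,
        Real.sq_sqrt zero_le_two, div_lt_iff₀' two_pos]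
    rw [radialLaw_Ioi hm ha, htail, ← ofReal_measureReal, hR.tail _ (by positivity), one_div_div,
      ← Real.rpow_natCast_mul (by positivity), Nat.cast_ofNat, mul_div_cancel₀ _ two_ne_zero,
      Real.rpow_natCast]

section NearestPointLaw

variable (T : Type*) [NormedAddCommGroup T] [InnerProductSpace ℝ T] [FiniteDimensional ℝ T]
  [MeasurableSpace T] [BorelSpace T]

/-- The uniform probability measure on the unit sphere of `T`. -/
noncomputable def uniformSphere : Measure (Metric.sphere (0 : T) 1) :=
  ((volume : Measure T).toSphere Set.univ)⁻¹ • (volume : Measure T).toSphere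

/-- The limit law of the rescaled point nearest to the query, on the tangent space. -/
noncomputable def nearestPointLaw : Measure T :=
  volume.withDensity fun u ↦
    ENNReal.ofReal ((unitDepthVolume T)⁻¹ * Real.exp (-(‖u‖ / √2) ^ Module.finrank ℝ T))

variable {T}

theorem lintegral_polar [Nontrivial T] {G : T → ENNReal} (hG : Measurable G) :
    ∫⁻ u, G u = ∫⁻ θ : Metric.sphere (0 : T) 1, (∫⁻ r in Set.Ioi (0 : ℝ),
      ENNReal.ofReal (r ^ (Module.finrank ℝ T - 1)) * G (r • (θ : T)))
        ∂(volume : Measure T).toSphere := by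
  have hG' : Measurable fun p : Metric.sphere (0 : T) 1 × Set.Ioi (0 : ℝ) ↦
      G ((p.2 : ℝ) • (p.1 : T)) := by fun_prop
  calc ∫⁻ u, G u = ∫⁻ u : ({0}ᶜ : Set T), G u ∂(Measure.comap Subtype.val volume) := by
        rw [lintegral_subtype_comap (measurableSet_singleton _).compl, restrict_compl_singleton]
    _ = ∫⁻ u : ({0}ᶜ : Set T), G (((homeomorphUnitSphereProd T u).2 : ℝ) •
          ((homeomorphUnitSphereProd T u).1 : T)) ∂(Measure.comap Subtype.val volume) := by
        simp_rw [← homeomorphUnitSphereProd_symm_apply_coe, Homeomorph.symm_apply_apply]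
    _ = ∫⁻ p, G ((p.2 : ℝ) • (p.1 : T)) ∂((volume : Measure T).toSphere.prod
          (Measure.volumeIoiPow (Module.finrank ℝ T - 1))) :=
        (volume : Measure T).measurePreserving_homeomorphUnitSphereProd.lintegral_comp hG'
    _ = ∫⁻ θ, ∫⁻ r, G ((r : ℝ) • (θ : T)) ∂(Measure.volumeIoiPow (Module.finrank ℝ T - 1))
          ∂(volume : Measure T).toSphere := lintegral_prod _ hG'.aemeasurable
    _ = _ := by
        refine lintegral_congr fun θ ↦ ?_
        rw [Measure.volumeIoiPow, lintegral_withDensity_eq_lintegral_mul _ (by fun_prop)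
          (by fun_prop)]
        exact lintegral_subtype_comap measurableSet_Ioi
          fun r : ℝ ↦ ENNReal.ofReal (r ^ (Module.finrank ℝ T - 1)) * G (r • (θ : T))

theorem toSphere_univ_eq_unitDepthVolume [Nontrivial T] :
    (volume : Measure T).toSphere Set.univ = ENNReal.ofReal
      (Module.finrank ℝ T / √2 ^ Module.finrank ℝ T * unitDepthVolume T) := by
  have hball : volume.real (Metric.ball (0 : T) 1) =
      (√2 ^ Module.finrank ℝ T)⁻¹ * unitDepthVolume T := by
    rw [← Measure.addHaar_real_closedBall_eq_addHaar_real_ball,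
      volume_real_closedBall zero_le_one, div_pow, one_pow, one_div]
  rw [← ofReal_measureReal, Measure.toSphere_real_apply_univ, hball, div_eq_mul_inv, mul_assoc]

theorem isProbabilityMeasure_uniformSphere [Nontrivial T] :
    IsProbabilityMeasure (uniformSphere T) := by
  have : NeZero (volume : Measure T).toSphere := ⟨Measure.toSphere_ne_zero _⟩
  exact isProbabilityMeasureSMul

theorem map_smul_radialLaw_prod_uniformSphere [Nontrivial T] :
    ((radialLaw (Module.finrank ℝ T)).prod (uniformSphere T)).map (fun p ↦ p.1 • (p.2 : T)) =
      nearestPointLaw T := by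
  have hm : 0 < Module.finrank ℝ T := Module.finrank_pos
  have hv := unitDepthVolume_pos (T := T)
  have := isProbabilityMeasure_radialLaw hm.ne'
  have := isProbabilityMeasure_uniformSphere (T := T)
  have hsmul : Measurable fun p : ℝ × Metric.sphere (0 : T) 1 ↦ p.1 • (p.2 : T) := by fun_prop
  refine Measure.ext_of_lintegral _ fun G hG ↦ ?_
  rw [lintegral_map hG hsmul, lintegral_prod_symm _ (by fun_prop), uniformSphere,
    lintegral_smul_measure, nearestPointLaw,
    lintegral_withDensity_eq_lintegral_mul _ (by fun_prop) hG, lintegral_polar (by fun_prop),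
    smul_eq_mul, toSphere_univ_eq_unitDepthVolume, ← ENNReal.ofReal_inv_of_pos (by positivity),
    ← lintegral_const_mul' _ _ ENNReal.ofReal_ne_top]
  refine lintegral_congr fun θ ↦ ?_
  rw [radialLaw, lintegral_withDensity_eq_lintegral_mul _ (by fun_prop) (by fun_prop),
    ← lintegral_const_mul' _ _ ENNReal.ofReal_ne_top]
  refine setLIntegral_congr_fun measurableSet_Ioi fun r (hr : 0 < r) ↦ ?_
  simp only [Pi.mul_apply]
  rw [← mul_assoc, ← mul_assoc, ← ENNReal.ofReal_mul (by positivity),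
    ← ENNReal.ofReal_mul (by positivity), norm_smul, norm_eq_of_mem_sphere, mul_one,
    Real.norm_of_nonneg hr.le]
  congr 2
  field_simp

theorem isProbabilityMeasure_nearestPointLaw [Nontrivial T] :
    IsProbabilityMeasure (nearestPointLaw T) := by
  have := isProbabilityMeasure_radialLaw (Module.finrank_pos (R := ℝ) (M := T)).ne'
  have := isProbabilityMeasure_uniformSphere (T := T)
  rw [← map_smul_radialLaw_prod_uniformSphere]
  exact Measure.isProbabilityMeasure_map (by fun_prop)

theorem map_sqrt_smul_eq_nearestPointLaw [Nontrivial T] {Ω : Type*} [MeasurableSpace Ω]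
    {P : Measure Ω} [IsProbabilityMeasure P] {R : Ω → ℝ}
    (hR : IsWeibull P (2 / Module.finrank ℝ T) R) {Θ : Ω → Metric.sphere (0 : T) 1}
    (hΘm : Measurable Θ) (hΘ : P.map Θ = uniformSphere T) (hind : IndepFun R Θ P) :
    P.map (fun ω ↦ √(2 * R ω) • (Θ ω : T)) = nearestPointLaw T := by
  have hSm : Measurable fun ω ↦ √(2 * R ω) := (hR.measurable.const_mul 2).sqrt
  have hjoint : P.map (fun ω ↦ (√(2 * R ω), Θ ω)) =
      (radialLaw (Module.finrank ℝ T)).prod (uniformSphere T) := by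
    rw [← hR.map_sqrt_two_mul Module.finrank_pos.ne', ← hΘ]
    exact (indepFun_iff_map_prod_eq_prod_map_map hSm.aemeasurable hΘm.aemeasurable).1
      (hind.comp (φ := fun r : ℝ ↦ √(2 * r)) (ψ := id) (by fun_prop) measurable_id)
  rw [← map_smul_radialLaw_prod_uniformSphere, ← hjoint,
    Measure.map_map (by fun_prop) (hSm.prodMk hΘm)]
  rfl

theorem setIntegral_nearestPointLaw (f : T → ℝ) {A : Set T} (hA : MeasurableSet A) :
    ∫ u in A, f u ∂(nearestPointLaw T) = (unitDepthVolume T)⁻¹ *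
      ∫ u in A, f u * Real.exp (-(‖u‖ / √2) ^ Module.finrank ℝ T) := by
  have hv := unitDepthVolume_pos (T := T)
  rw [nearestPointLaw, restrict_withDensity hA,
    integral_withDensity_eq_integral_toReal_smul (by fun_prop) (by simp), ← integral_const_mul]
  congr with u
  rw [ENNReal.toReal_ofReal (by positivity), smul_eq_mul]
  ring

end NearestPointLaw

section TendstoInDistribution

variable {ι Ω Ω' E : Type*} {l : Filter ι} [MeasurableSpace Ω] {P : Measure Ω}
  [IsProbabilityMeasure P] [MeasurableSpace Ω'] {P' : Measure Ω'} [IsProbabilityMeasure P']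
  [MeasurableSpace E]

theorem tendstoInMeasure_of_tendstoInDistribution_const [PseudoEMetricSpace E]
    [OpensMeasurableSpace E] {X : ι → Ω → E} {c : E}
    (h : TendstoInDistribution X l (fun _ : Ω' ↦ c) (fun _ ↦ P) P') :
    TendstoInMeasure P X l fun _ ↦ c := by
  intro ε hε
  have hF : IsClosed {z | ε ≤ edist z c} := isClosed_le continuous_const (by fun_prop)
  have hc : c ∉ frontier {z | ε ≤ edist z c} := fun hc ↦ by
    simpa [hε.ne'] using hF.frontier_subset hc
  have hlim := ProbabilityMeasure.tendsto_measure_of_null_frontier_of_tendsto' h.tendsto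
    (E := {z | ε ≤ edist z c})
    (by simp [Measure.map_const, Measure.dirac_apply' c isClosed_frontier.measurableSet, hc])
  simpa [Measure.map_const, Measure.dirac_apply' c hF.measurableSet, hε.ne',
    Measure.map_apply_of_aemeasurable (h.forall_aemeasurable _) hF.measurableSet] using hlim

theorem tendstoInMeasure_zero_of_tendstoInDistribution_smul [NormedAddCommGroup E]
    [NormedSpace ℝ E] [SecondCountableTopology E] [BorelSpace E] {c : ℕ → ℝ}
    (hc : Tendsto c atTop atTop) {Y : ℕ → Ω → E} {Z : Ω' → E}
    (h : TendstoInDistribution (fun n ω ↦ c n • Y n ω) atTop Z (fun _ ↦ P) P') :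
    TendstoInMeasure P Y atTop fun _ ↦ 0 := by
  have hinv : TendstoInMeasure P (fun n _ ↦ (c n)⁻¹) atTop fun _ ↦ (0 : ℝ) :=
    tendstoInMeasure_of_tendsto_ae (fun _ ↦ aestronglyMeasurable_const)
      (.of_forall fun _ ↦ hc.inv_tendsto_atTop)
  have hzero := h.continuous_comp_prodMk_of_tendstoInMeasure_const
    (g := fun p : E × ℝ ↦ p.2 • p.1) (by fun_prop) hinv (by fun_prop)
  simp only [zero_smul] at hzero
  refine (tendstoInMeasure_of_tendstoInDistribution_const hzero).congr' ?_ .rfl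
  filter_upwards [hc.eventually_ne_atTop 0] with n hn
  exact .of_forall fun ω ↦ inv_smul_smul₀ hn _

end TendstoInDistribution

theorem tendsto_of_forall_abs_sub_le {ι κ : Type*} {l : Filter ι} {l' : Filter κ} [l'.NeBot]
    {A : ι → ℝ} {B e : κ → ι → ℝ} {b δ : κ → ℝ} {c : ℝ}
    (hB : ∀ᶠ k in l', Tendsto (B k) l (𝓝 (b k))) (he : ∀ᶠ k in l', Tendsto (e k) l (𝓝 (δ k)))
    (hA : ∀ᶠ k in l', ∀ᶠ i in l, |A i - B k i| ≤ e k i) (hb : Tendsto b l' (𝓝 c))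
    (hδ : Tendsto δ l' (𝓝 0)) : Tendsto A l (𝓝 c) := by
  refine Metric.tendsto_nhds.2 fun ε hε ↦ ?_
  obtain ⟨k, hBk, hek, hAk, hbk, hδk⟩ := (hB.and <| he.and <| hA.and <|
    (Metric.tendsto_nhds.1 hb (ε / 3) (by positivity)).and
      (hδ.eventually_lt_const (show 0 < ε / 3 by positivity))).exists
  filter_upwards [hAk, hek.eventually_lt_const hδk,
    Metric.tendsto_nhds.1 hBk (ε / 3) (by positivity)] with i hAi hei hBi
  rw [Real.dist_eq] at *
  linarith [abs_sub_le (A i) (B k i) c, abs_sub_le (B k i) (b k) c]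

section GnomonicDensity

variable {d : ℕ} (q : UnitSphere d) {ρ : UnitSphere d → ℝ}

/-- The density, in the gnomonic chart at `q`, of the measure on the hemisphere around `q` with
density `ρ` with respect to surface measure. -/
noncomputable def gnomonicDensity (ρ : UnitSphere d → ℝ) (v : TangentAt q) : ℝ :=
  (√(1 + ‖v‖ ^ 2))⁻¹ ^ d * ρ (gnomonicChart q v)

theorem gnomonicDensity_zero : gnomonicDensity q ρ 0 = ρ q := by
  simp [gnomonicDensity, gnomonicChart_zero]

theorem contextLaw_restrict_hemisphere (hρm : Measurable ρ) :
    (contextLaw ρ).restrict {x | queryDepth q x < 1} =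
      (volume.withDensity fun v ↦ ENNReal.ofReal (gnomonicDensity q ρ v)).map
        (gnomonicChart q) := by
  have hγ := (continuous_gnomonicChart q).measurable
  have hH : MeasurableSet {x | queryDepth q x < 1} :=
    measurableSet_lt (continuous_queryDepth q).measurable measurable_const
  rw [contextLaw, restrict_withDensity hH, surfaceMeasure_restrict_hemisphere]
  ext A hA
  rw [withDensity_apply _ hA, setLIntegral_map hA hρm.ennreal_ofReal hγ,
    Measure.map_apply hγ hA, withDensity_apply _ (hγ hA),
    setLIntegral_withDensity_eq_setLIntegral_mul _ (by fun_prop)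
      (g := fun v ↦ ENNReal.ofReal (ρ (gnomonicChart q v))) (by fun_prop) (hγ hA)]
  exact lintegral_congr fun v ↦ (ENNReal.ofReal_mul (by positivity)).symm

theorem isGnomonicModel_contextLaw (hρ0 : ∀ x, 0 ≤ ρ x) (hρm : Measurable ρ)
    (hρ : ContinuousAt ρ q) :
    IsGnomonicModel (contextLaw ρ) (queryDepth q) (gnomonicChart q) (gnomonicDensity q ρ) where
  measurable_depth := (continuous_queryDepth q).measurable
  depth_nonneg := queryDepth_nonneg q
  measurable_chart := (continuous_gnomonicChart q).measurable
  depth_chart := queryDepth_gnomonicChart q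
  measurable_density := by
    have hγ := (continuous_gnomonicChart q).measurable
    unfold gnomonicDensity
    fun_prop
  continuousAt_density := by
    have hweight : Continuous fun v : TangentAt q ↦ (√(1 + ‖v‖ ^ 2))⁻¹ :=
      Continuous.inv₀ (by fun_prop) fun v ↦ by positivity
    refine (hweight.pow d).continuousAt.mul (ContinuousAt.comp ?_
      (continuous_gnomonicChart q).continuousAt)
    rwa [gnomonicChart_zero]
  density_nonneg v := mul_nonneg (by positivity) (hρ0 _)
  restrict_eq := contextLaw_restrict_hemisphere q hρm

theorem tendsto_smul_gnomonicChart_sub {ι : Type*} {l : Filter ι} {s : ι → ℝ}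
    (hs : Tendsto s l atTop) (u : TangentAt q) :
    Tendsto (fun i ↦ s i • ((gnomonicChart q ((s i)⁻¹ • u)).1 - q.1)) l (𝓝 u.1) := by
  set δ : ι → ℝ := fun i ↦ gnomonicDepth ((s i)⁻¹ * ‖u‖)
  have hinv := hs.inv_tendsto_atTop
  have hδ : Tendsto δ l (𝓝 0) := by
    have hlim := (continuous_gnomonicDepth.tendsto _).comp (hinv.mul_const ‖u‖)
    rwa [zero_mul, gnomonicDepth_zero] at hlim
  have hsδ : Tendsto (fun i ↦ s i * δ i) l (𝓝 0) := by
    have hlim := (tendsto_sq_mul_gnomonicDepth hs ‖u‖).mul hinv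
    rw [mul_zero] at hlim
    refine hlim.congr' ?_
    filter_upwards [hs.eventually_ne_atTop 0] with i hi
    rw [Pi.inv_apply, mul_right_comm, sq, mul_inv_cancel_right₀ hi]
  have hlim := ((hδ.const_sub 1).smul_const u.1).sub (hsδ.smul_const q.1)
  rw [sub_zero, one_smul, zero_smul, sub_zero] at hlim
  refine hlim.congr' ?_
  filter_upwards [hs.eventually_gt_atTop 0] with i hi
  have hnorm : (√(1 + ‖(s i)⁻¹ • u‖ ^ 2))⁻¹ = 1 - δ i := by
    simp only [δ, gnomonicDepth, norm_smul, norm_inv, Real.norm_of_nonneg hi.le, sub_sub_cancel]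
  simp only [gnomonicChart, hnorm, Submodule.coe_smul]
  match_scalars <;> field_simp
  ring

end GnomonicDensity

section Limit

variable {d : ℕ} {q : UnitSphere d} [Nontrivial (TangentAt q)] {μ : Measure (UnitSphere d)}
  [IsProbabilityMeasure μ] {h : TangentAt q → ℝ} {s β : ℕ → ℝ}

theorem tendsto_integral_attentionShift
    (H : IsGnomonicModel μ (queryDepth q) (gnomonicChart q) h) (h0 : 0 < h 0)
    (hs : Tendsto s atTop atTop)
    (hsn : ∀ n : ℕ, s n ^ Module.finrank ℝ (TangentAt q) = IsGnomonicModel.intensity h * n)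
    (hβ : Tendsto (fun n ↦ β n / s n ^ 2) atTop atTop) {f : EuclideanSpace ℝ (Fin d) → ℝ} {M : ℝ}
    (hM : ∀ z, |f z| ≤ M) {K : NNReal} (hK : LipschitzWith K f) :
    Tendsto (fun n : ℕ ↦ ∫ x : Fin n → UnitSphere d, f (s n • attentionShift (β n) q x)
      ∂(Measure.pi fun _ ↦ μ)) atTop (𝓝 (∫ u, f u ∂(nearestPointLaw (TangentAt q)))) := by
  have := isProbabilityMeasure_nearestPointLaw (T := TangentAt q)
  have hm : Module.finrank ℝ (TangentAt q) ≠ 0 := Module.finrank_pos.ne'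
  have hf := hK.continuous.measurable
  have hball : Tendsto (fun L : ℝ ↦ ∫ u in Metric.closedBall 0 L, f u
      ∂(nearestPointLaw (TangentAt q))) atTop (𝓝 (∫ u, f u ∂(nearestPointLaw (TangentAt q)))) :=
    (aecover_closedBall tendsto_id).integral_tendsto_of_countably_generated
      (.of_bound (hf.comp measurable_subtype_coe).aestronglyMeasurable M (ae_of_all _ fun _ ↦ hM _))
  have ha (L : ℝ) : Tendsto (fun n ↦ s n ^ 2 * ((L / s n) ^ 2 / 2)) atTop (𝓝 (L ^ 2 / 2)) := by
    refine tendsto_const_nhds.congr' ?_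
    filter_upwards [hs.eventually_ne_atTop 0] with n hn
    field_simp
  refine tendsto_of_forall_abs_sub_le (l' := atTop)
    (B := fun L n ↦ n * ∫ x in {x | queryDepth q x ≤ (L / s n) ^ 2 / 2}, f (s n • (x.1 - q.1)) *
      μ.real {y | queryDepth q x < queryDepth q y} ^ (n - 1) ∂μ)
    (e := fun L n ↦ M * μ.real {x | (L / s n) ^ 2 / 2 < queryDepth q x} ^ n +
      (M + 3 * K) * (n ^ 2 * ∫ x, ∫ y, pairWeight (queryDepth q) (β n) (s n)
        ((L / s n) ^ 2 / 2) x y ∂μ ∂μ)) ?_ ?_ ?_ hball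
    (by simpa using (tendsto_exp_neg_div_sqrt_two_pow hm).const_mul M)
  · filter_upwards [eventually_ge_atTop 0] with L hL
    rw [setIntegral_nearestPointLaw _ Metric.isClosed_closedBall.measurableSet]
    exact H.tendsto_nearest_term h0 hs hsn (ha L) hL (fun n ↦ hf.comp (by fun_prop))
      (fun n x ↦ hM _) fun u ↦
        (hK.continuous.tendsto _).comp (tendsto_smul_gnomonicChart_sub q hs u)
  · filter_upwards [eventually_ge_atTop 0] with L hL
    simpa using ((H.tendsto_depth_gt_pow h0 hs hsn (ha L) hL).const_mul M).add
      ((H.tendsto_pair_term h0 hs hsn hβ (ha L) hL).const_mul (M + 3 * K))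
  · refine .of_forall fun L ↦ ?_
    filter_upwards [hs.eventually_gt_atTop 0, hβ.eventually_ge_atTop 1, eventually_ne_atTop 0]
      with n hsn hβn hn
    have : NeZero n := ⟨hn⟩
    exact abs_integral_attentionShift_sub_nearest_le hM hK hsn.le
      ((one_le_div (by positivity)).1 hβn) _

variable {Ω : Type*} [MeasurableSpace Ω] {P : Measure Ω} [IsProbabilityMeasure P]
  {X : ℕ → Ω → UnitSphere d}

theorem map_iid_eq_pi {S : Type*} [MeasurableSpace S] {X : ℕ → Ω → S} {μ : Measure S}
    [SigmaFinite μ] (hXm : ∀ i, Measurable (X i)) (hXi : iIndepFun X P)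
    (hXl : ∀ i, P.map (X i) = μ) (n : ℕ) :
    P.map (fun ω (j : Fin n) ↦ X j ω) = Measure.pi fun _ ↦ μ := by
  rw [(iIndepFun_iff_map_fun_eq_pi_map fun j : Fin n ↦ (hXm j).aemeasurable).1
    (hXi.precomp Fin.val_injective)]
  simp only [hXl]

theorem tendstoInDistribution_attentionShift
    (H : IsGnomonicModel μ (queryDepth q) (gnomonicChart q) h) (h0 : 0 < h 0)
    (hXm : ∀ i, Measurable (X i)) (hXi : iIndepFun X P) (hXl : ∀ i, P.map (X i) = μ)
    (hs : Tendsto s atTop atTop)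
    (hsn : ∀ n : ℕ, s n ^ Module.finrank ℝ (TangentAt q) = IsGnomonicModel.intensity h * n)
    (hβ : Tendsto (fun n ↦ β n / s n ^ 2) atTop atTop) {Ω' : Type*} [MeasurableSpace Ω']
    {P' : Measure Ω'} [IsProbabilityMeasure P'] {Z : Ω' → TangentAt q} (hZm : AEMeasurable Z P')
    (hZ : P'.map Z = nearestPointLaw (TangentAt q)) :
    TendstoInDistribution (fun (n : ℕ) ω ↦ s n • attentionShift (β n) q (fun j : Fin n ↦ X j ω))
      atTop (fun ω' ↦ (Z ω').1) (fun _ ↦ P) P' := by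
  have hAm (n : ℕ) : Measurable fun x : Fin n → UnitSphere d ↦ s n • attentionShift (β n) q x :=
    (measurable_attentionShift n (β n) q).const_smul (s n)
  have hctx (n : ℕ) : Measurable fun ω (j : Fin n) ↦ X j ω := measurable_pi_lambda _ fun j ↦ hXm j
  have hlaw (n : ℕ) : P.map (fun ω ↦ s n • attentionShift (β n) q fun j : Fin n ↦ X j ω) =
      (Measure.pi fun _ ↦ μ).map fun x : Fin n → UnitSphere d ↦
        s n • attentionShift (β n) q x := by
    rw [← map_iid_eq_pi hXm hXi hXl, Measure.map_map (hAm n) (hctx n), Function.comp_def]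
  have hlaw' : P'.map (fun ω' ↦ (Z ω').1) = (nearestPointLaw (TangentAt q)).map Subtype.val := by
    rw [← hZ, AEMeasurable.map_map_of_aemeasurable (by fun_prop) hZm, Function.comp_def]
  refine ⟨fun n ↦ ((hAm n).comp (hctx n)).aemeasurable, by fun_prop,
    tendsto_iff_forall_lipschitz_integral_tendsto.2 fun f ⟨D, hD⟩ ⟨K, hK⟩ ↦ ?_⟩
  have hf := hK.continuous.stronglyMeasurable
  have hM (z) : |f z| ≤ D + |f 0| := by
    have hD0 := hD z 0
    rw [Real.dist_eq] at hD0
    linarith [abs_sub_abs_le_abs_sub (f z) (f 0)]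
  change Tendsto (fun n ↦ ∫ z, f z ∂(P.map _)) atTop (𝓝 (∫ z, f z ∂(P'.map _)))
  simp_rw [hlaw, hlaw', integral_map (hAm _).aemeasurable hf.aestronglyMeasurable,
    integral_map measurable_subtype_coe.aemeasurable hf.aestronglyMeasurable]
  exact tendsto_integral_attentionShift H h0 hs hsn hβ hM hK

end Limit

section Scale

variable {C α : ℝ}

theorem sqrt_rpow_two_div_pow {m : ℕ} (hm : m ≠ 0) {x : ℝ} (hx : 0 ≤ x) :
    √(x ^ (2 / (m : ℝ))) ^ m = x := by
  rw [Real.sqrt_eq_rpow, ← Real.rpow_mul hx, ← Real.rpow_natCast, ← Real.rpow_mul hx,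
    show 2 / (m : ℝ) * (1 / 2) * m = 1 by field_simp, Real.rpow_one]

theorem tendsto_sqrt_mul_rpow_atTop (hC : 0 < C) (hα : 0 < α) :
    Tendsto (fun n : ℕ ↦ √((C * n) ^ α)) atTop atTop :=
  Real.tendsto_sqrt_atTop.comp <| (tendsto_rpow_atTop hα).comp <|
    tendsto_natCast_atTop_atTop.const_mul_atTop hC

theorem tendsto_div_sqrt_mul_rpow_sq_atTop (hC : 0 < C) {β : ℕ → ℝ}
    (hβ : Tendsto (fun n : ℕ ↦ β n * (n : ℝ) ^ (-α)) atTop atTop) :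
    Tendsto (fun n : ℕ ↦ β n / √((C * n) ^ α) ^ 2) atTop atTop := by
  refine (hβ.const_mul_atTop (show 0 < (C ^ α)⁻¹ by positivity)).congr fun n ↦ ?_
  rw [Real.sq_sqrt (by positivity), Real.mul_rpow hC.le n.cast_nonneg,
    Real.rpow_neg n.cast_nonneg, div_eq_mul_inv, mul_inv]
  ring

end Scale

section SphericalContext

variable {d : ℕ} (q : UnitSphere d)

theorem nontrivial_tangentAt (hd : 2 ≤ d) : Nontrivial (TangentAt q) :=
  (Module.finrank_pos_iff (R := ℝ)).1 (by have := finrank_tangentAt_add_one q; omega)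

theorem alphaExp_pos (hd : 2 ≤ d) : 0 < alphaExp d := by
  have : (2 : ℝ) ≤ d := by exact_mod_cast hd
  exact div_pos two_pos (by linarith)

theorem alphaExp_eq_two_div_finrank : alphaExp d = 2 / Module.finrank ℝ (TangentAt q) := by
  simp [alphaExp, ← finrank_tangentAt_add_one q]

variable {q} [Nontrivial (TangentAt q)] {ρ : UnitSphere d → ℝ}

theorem tendsto_d2qCDF_mul_rpow [IsFiniteMeasure (contextLaw ρ)] (hρ0 : ∀ x, 0 ≤ ρ x)
    (hρm : Measurable ρ) (hρ : ContinuousAt ρ q) :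
    Tendsto (fun t ↦ d2qCDF q ρ t * t ^ (-(1 / alphaExp d))) (𝓝[>] 0)
      (𝓝 (IsGnomonicModel.intensity (gnomonicDensity q ρ))) := by
  rw [alphaExp_eq_two_div_finrank q, one_div_div]
  exact (isGnomonicModel_contextLaw q hρ0 hρm hρ).tendsto_cdf_mul_rpow

theorem localIntensity_eq_intensity [IsFiniteMeasure (contextLaw ρ)] (hρ0 : ∀ x, 0 ≤ ρ x)
    (hρm : Measurable ρ) (hρ : ContinuousAt ρ q) :
    localIntensity q ρ = IsGnomonicModel.intensity (gnomonicDensity q ρ) :=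
  (tendsto_d2qCDF_mul_rpow hρ0 hρm hρ).limUnder_eq

theorem localIntensity_pos [IsFiniteMeasure (contextLaw ρ)] (hρ0 : ∀ x, 0 ≤ ρ x)
    (hρq : 0 < ρ q) (hρm : Measurable ρ) (hρ : ContinuousAt ρ q) : 0 < localIntensity q ρ := by
  rw [localIntensity_eq_intensity hρ0 hρm hρ]
  exact IsGnomonicModel.intensity_pos (by rwa [gnomonicDensity_zero])

theorem tendstoInDistribution_attentionDisplacement {Ω : Type*} [MeasurableSpace Ω]
    {P : Measure Ω} [IsProbabilityMeasure P] {X : ℕ → Ω → UnitSphere d}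
    [IsProbabilityMeasure (contextLaw ρ)]
    (hXm : ∀ i, Measurable (X i)) (hXi : iIndepFun X P) (hXl : ∀ i, P.map (X i) = contextLaw ρ)
    (hρ0 : ∀ x, 0 ≤ ρ x) (hρq : 0 < ρ q) (hρm : Measurable ρ) (hρ : ContinuousAt ρ q)
    (V : Matrix (Fin d) (Fin d) ℝ) {β : ℕ → ℝ}
    (hβ : Tendsto (fun n : ℕ ↦ β n * (n : ℝ) ^ (-alphaExp d)) atTop atTop) {Ω' : Type*}
    [MeasurableSpace Ω'] {P' : Measure Ω'} [IsProbabilityMeasure P'] {Z : Ω' → TangentAt q}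
    (hZm : AEMeasurable Z P') (hZ : P'.map Z = nearestPointLaw (TangentAt q)) :
    TendstoInDistribution
      (fun (n : ℕ) ω ↦ √((localIntensity q ρ * n) ^ alphaExp d) •
        attentionDisplacement V (β n) q (fun j : Fin n ↦ X j ω)) atTop
      (fun ω' ↦ Matrix.toEuclideanCLM (𝕜 := ℝ) V (Z ω').1) (fun _ ↦ P) P' := by
  have hC := localIntensity_pos hρ0 hρq hρm hρ
  have hm : Module.finrank ℝ (TangentAt q) ≠ 0 := Module.finrank_pos.ne'
  have hα : 0 < alphaExp d := by
    rw [alphaExp_eq_two_div_finrank q]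
    exact div_pos two_pos (Nat.cast_pos.2 Module.finrank_pos)
  have hsn (n : ℕ) : √((localIntensity q ρ * n) ^ alphaExp d) ^ Module.finrank ℝ (TangentAt q) =
      IsGnomonicModel.intensity (gnomonicDensity q ρ) * n := by
    rw [alphaExp_eq_two_div_finrank q, sqrt_rpow_two_div_pow hm (by positivity),
      localIntensity_eq_intensity hρ0 hρm hρ]
  have hshift := tendstoInDistribution_attentionShift (isGnomonicModel_contextLaw q hρ0 hρm hρ)
    (by rwa [gnomonicDensity_zero]) hXm hXi hXl (tendsto_sqrt_mul_rpow_atTop hC hα) hsn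
    (tendsto_div_sqrt_mul_rpow_sq_atTop hC hβ) hZm hZ
  simpa only [Function.comp_def, map_smul, ← attentionDisplacement_eq] using
    hshift.continuous_comp (Matrix.toEuclideanCLM (𝕜 := ℝ) V).continuous

end SphericalContext

theorem theorem4p1_general {d : ℕ} (hd : 2 ≤ d) {Ω : Type*} [MeasurableSpace Ω] (P : Measure Ω)
    [IsProbabilityMeasure P] (q : UnitSphere d) (ρ : UnitSphere d → ℝ) (X : ℕ → Ω → UnitSphere d)
    (hXm : ∀ i, Measurable (X i)) (hXi : iIndepFun X P) (hXl : ∀ i, P.map (X i) = contextLaw ρ)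
    (hρ0 : ∀ x, 0 ≤ ρ x) (hρq : 0 < ρ q) (hρm : Measurable ρ) (hρ : ContinuousAt ρ q)
    (V : Matrix (Fin d) (Fin d) ℝ) (β : ℕ → ℝ)
    (hβ : Tendsto (fun n : ℕ ↦ β n * (n : ℝ) ^ (-alphaExp d)) atTop atTop) :
    (Tendsto (fun t : ℝ ↦ d2qCDF q ρ t * t ^ (-(1 / alphaExp d))) (𝓝[>] 0)
        (𝓝 (localIntensity q ρ)) ∧ 0 < localIntensity q ρ) ∧
    (∀ {Ω' : Type*} [MeasurableSpace Ω'] (P' : Measure Ω') [IsProbabilityMeasure P']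
        (R : Ω' → ℝ) (Θ : Ω' → TangentSphere q),
        IsWeibull P' (alphaExp d) R → Measurable Θ → P'.map Θ = tangentUniform q →
        IndepFun R Θ P' →
        TendstoInDistribution
          (fun (n : ℕ) ω ↦ √((localIntensity q ρ * (n : ℝ)) ^ alphaExp d) •
            attentionDisplacement V (β n) q (fun j : Fin n ↦ X j ω))
          atTop
          (fun ω' ↦ Matrix.toEuclideanCLM (𝕜 := ℝ) V
            (√(2 * R ω') • ((Θ ω' : TangentAt q) : EuclideanSpace ℝ (Fin d))))
          (fun _ ↦ P) P') ∧
    TendstoInMeasure P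
      (fun (n : ℕ) ω ↦ attentionDisplacement V (β n) q (fun j : Fin n ↦ X j ω)) atTop
      (fun _ ↦ 0) ∧
    TendstoInMeasure P
      (fun (n : ℕ) ω ↦ attentionOutput V (β n) q (fun j : Fin n ↦ X j ω)) atTop
      (fun _ ↦ Matrix.toEuclideanCLM (𝕜 := ℝ) V (q : EuclideanSpace ℝ (Fin d))) := by
  have : IsProbabilityMeasure (contextLaw ρ) :=
    hXl 0 ▸ Measure.isProbabilityMeasure_map (hXm 0).aemeasurable
  have := nontrivial_tangentAt q hd
  have := isProbabilityMeasure_nearestPointLaw (T := TangentAt q)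
  have hC := localIntensity_pos hρ0 hρq hρm hρ
  have hdisp : TendstoInMeasure P
      (fun (n : ℕ) ω ↦ attentionDisplacement V (β n) q (fun j : Fin n ↦ X j ω)) atTop fun _ ↦ 0 :=
    tendstoInMeasure_zero_of_tendstoInDistribution_smul
      (tendsto_sqrt_mul_rpow_atTop hC (alphaExp_pos hd))
      (tendstoInDistribution_attentionDisplacement hXm hXi hXl hρ0 hρq hρm hρ V hβ aemeasurable_id
        Measure.map_id)
  refine ⟨⟨?_, hC⟩, fun P' _ R Θ hR hΘm hΘ hind ↦ ?_, hdisp, ?_⟩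
  · rw [localIntensity_eq_intensity hρ0 hρm hρ]
    exact tendsto_d2qCDF_mul_rpow hρ0 hρm hρ
  · rw [alphaExp_eq_two_div_finrank q] at hR
    have hZm : Measurable fun ω' ↦ √(2 * R ω') • (Θ ω' : TangentAt q) :=
      (hR.measurable.const_mul 2).sqrt.smul (measurable_subtype_coe.comp hΘm)
    simpa only [Submodule.coe_smul] using tendstoInDistribution_attentionDisplacement hXm hXi hXl
      hρ0 hρq hρm hρ V hβ hZm.aemeasurable (map_sqrt_smul_eq_nearestPointLaw hR hΘm hΘ hind)
  · rw [tendstoInMeasure_iff_norm] at hdisp ⊢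
    simpa only [attentionDisplacement, sub_zero] using hdisp

theorem theorem4p1 {d : ℕ} (hd : 2 ≤ d)
    {Ω : Type*} [MeasurableSpace Ω] (P : Measure Ω) [IsProbabilityMeasure P]
    (q : UnitSphere d) (ρ : UnitSphere d → ℝ) (X : ℕ → Ω → UnitSphere d)
    (hX : IsIIDSphericalContext hd P q ρ X)
    (V : Matrix (Fin d) (Fin d) ℝ) (β : ℕ → ℝ)
    (hβ : Tendsto (fun n : ℕ => β n * (n : ℝ) ^ (-alphaExp d)) atTop atTop) :
    -- the limit defining `C(q)` exists and is positive
    (Tendsto (fun t : ℝ => d2qCDF q ρ t * t ^ (-(1 / alphaExp d))) (𝓝[>] 0)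
        (𝓝 (localIntensity q ρ)) ∧ 0 < localIntensity q ρ) ∧
    -- convergence in distribution of the rescaled displacement
    (∀ {Ω' : Type*} [MeasurableSpace Ω'] (P' : Measure Ω') [IsProbabilityMeasure P']
        (R : Ω' → ℝ) (Θ : Ω' → TangentSphere q),
        IsWeibull P' (alphaExp d) R → Measurable Θ → P'.map Θ = tangentUniform q →
        IndepFun R Θ P' →
        TendstoInDistribution
          (fun (n : ℕ) ω => √((localIntensity q ρ * (n : ℝ)) ^ alphaExp d) •
            attentionDisplacement V (β n) q (fun j : Fin n => X j ω))
          atTop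
          (fun ω' => Matrix.toEuclideanCLM (𝕜 := ℝ) V
            (√(2 * R ω') • ((Θ ω' : TangentAt q) : EuclideanSpace ℝ (Fin d))))
          (fun _ => P) P') ∧
    -- convergence in probability
    TendstoInMeasure P
      (fun (n : ℕ) ω => attentionDisplacement V (β n) q (fun j : Fin n => X j ω)) atTop
      (fun _ => 0) ∧
    TendstoInMeasure P
      (fun (n : ℕ) ω => attentionOutput V (β n) q (fun j : Fin n => X j ω)) atTop
      (fun _ => Matrix.toEuclideanCLM (𝕜 := ℝ) V (q : EuclideanSpace ℝ (Fin d))) := by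
  have := finrank_fact_of_two_le hd
  have hρ : Continuous ρ := ContMDiff.continuous hX.density_C2
  exact theorem4p1_general hd P q ρ X hX.measurable hX.indep hX.law hX.density_nonneg hX.density_pos
    hρ.measurable hρ.continuousAt V β hβ
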